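/- Let $n>2$ and let $w$ be a permutation of $[n]=\{1,\dots,n\}$ with $\{w(1),\dots,w(r)\}\neq\{1,\dots,r\}$ for all $1\le r<n$. Let $X(w)$ be Elnitsky's polygon: an equilateral $2n$-gon whose sides, read counterclockwise from its topmost vertex, are labeled $1,\dots,n,w(n),\dots,w(1)$, in which the first $n$ sides (the leftside boundary) form the left half, from topmost to bottommost vertex, of a convex $2n$-gon, and in which two sides are parallel if and only if they have the same label; the last $n$ sides form the rightside boundary. The angles may be chosen arbitrarily subject to these conditions. A rhombic tiling of $X(w)$ is an edge-to-edge tiling of $X(w)$ by rhombi whose edges are congruent and parallel to sides of $X(w)$. A tile is a side-perimeter tile if two of its edges are sides in the leftside boundary of $X(w)$, or two of its edges are sides in the rightside boundary of $X(w)$. Then every rhombic tiling of $X(w)$ has exactly two side-perimeter tiles if and only if, for some $k\in[n-1]$, the one-line notation $w(1)w(2)\cdots w(n)$ of $w$ is $$(k+1)(k+2)\cdots n\,1\,2\cdots k\qquad\text{or}\qquad (k+1)(k+2)\cdots n\,k\,1\,2\cdots(k-1).$$ -/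

import Mathlib

noncomputable section

namespace Elnitsky

variable {n : ℕ}

/-! ### Permutations

Permutations of `{1, …, n}` are modelled by `Equiv.Perm (Fin n)`, the element `i : Fin n`
standing for `i + 1`. -/

/-- The one-line notation `w(1) w(2) ⋯ w(n)`, written with the letters `1, …, n`. -/
def oneLine (w : Equiv.Perm (Fin n)) : List ℕ :=
  List.ofFn fun i : Fin n => (w i : ℕ) + 1

/-- `{w(1), …, w(r)} ≠ {1, …, r}` for all `1 ≤ r < n`: the interior of the polygon `X(w)` is
contiguous. -/
def IsContiguous (w : Equiv.Perm (Fin n)) : Prop :=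
  ∀ r : ℕ, 1 ≤ r → r < n →
    w '' {i : Fin n | (i : ℕ) < r} ≠ {i : Fin n | (i : ℕ) < r}

/-! ### The polygon `X(w)`

The polygon is drawn in the plane `ℂ`, with its top vertex at `0` and with sides of length one. -/

/-- `θ i` is the direction of the side of `X(w)` with label `i` on the leftside boundary, traversed
from top to bottom (that is, counterclockwise). The directions point strictly downwards and turn
strictly to the left, so that the leftside boundary is half of a convex `2n`-gon, from its
topmost vertex to its bottommost one. -/
structure IsSideDirections (θ : Fin n → ℝ) : Prop where
  strictMono : StrictMono θ
  downward : ∀ i, θ i ∈ Set.Ioo Real.pi (2 * Real.pi)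

/-- The unit vector along a side with label `i`, pointing downwards. -/
def sideVec (θ : Fin n → ℝ) (i : Fin n) : ℂ :=
  ⟨Real.cos (θ i), Real.sin (θ i)⟩

/-- The vertex reached from the top vertex after the first `k` sides of the downward path whose
sides have the labels `u 1, u 2, …, u n` from top to bottom. -/
def pathVertex (θ : Fin n → ℝ) (u : Equiv.Perm (Fin n)) (k : ℕ) : ℂ :=
  ∑ j ∈ Finset.univ.filter (fun j : Fin n => (j : ℕ) < k), sideVec θ (u j)

/-- The side in position `j` (with label `u j`) of that path. -/
def pathSide (θ : Fin n → ℝ) (u : Equiv.Perm (Fin n)) (j : Fin n) : Set ℂ :=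
  segment ℝ (pathVertex θ u (j : ℕ)) (pathVertex θ u ((j : ℕ) + 1))

/-- The sides of the leftside boundary of `X(w)`, labelled `1, 2, …, n` from top to bottom
(they do not depend on `w`). -/
def leftSides (θ : Fin n → ℝ) : Set (Set ℂ) :=
  Set.range (pathSide θ 1)

/-- The sides of the rightside boundary of `X(w)`, labelled `w(1), w(2), …, w(n)` from top to
bottom. -/
def rightSides (θ : Fin n → ℝ) (w : Equiv.Perm (Fin n)) : Set (Set ℂ) :=
  Set.range (pathSide θ w)

/-- The closed region `X(w)` enclosed by the leftside and the rightside boundary. All side vectors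
point strictly downwards, so each of the two boundary paths meets a horizontal line in at most one
point, and the region consists of the points that lie, on their horizontal line, weakly between
the leftside and the rightside boundary. -/
def region (θ : Fin n → ℝ) (w : Equiv.Perm (Fin n)) : Set ℂ :=
  {z | ∃ p ∈ ⋃₀ leftSides θ, ∃ q ∈ ⋃₀ rightSides θ w,
    p.im = z.im ∧ q.im = z.im ∧ p.re ≤ z.re ∧ z.re ≤ q.re}

/-! ### Rhombic tilings -/

/-- A rhombus whose edges are congruent and parallel to sides of `X(w)`: it is determined by its
topmost vertex and its two edge labels. -/
@[ext]
structure Rhombus (n : ℕ) where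
  /-- the topmost vertex -/
  top : ℂ
  /-- the smaller edge label -/
  a : Fin n
  /-- the larger edge label -/
  b : Fin n
  a_lt_b : a < b

/-- The closed rhombus as a set of points. -/
def Rhombus.carrier (θ : Fin n → ℝ) (t : Rhombus n) : Set ℂ :=
  {z | ∃ x ∈ Set.Icc (0 : ℝ) 1, ∃ y ∈ Set.Icc (0 : ℝ) 1,
    z = t.top + x • sideVec θ t.a + y • sideVec θ t.b}

/-- The four edges of a rhombus. -/
def Rhombus.edges (θ : Fin n → ℝ) (t : Rhombus n) : Set (Set ℂ) :=
  {segment ℝ t.top (t.top + sideVec θ t.a),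
   segment ℝ t.top (t.top + sideVec θ t.b),
   segment ℝ (t.top + sideVec θ t.a) (t.top + sideVec θ t.a + sideVec θ t.b),
   segment ℝ (t.top + sideVec θ t.b) (t.top + sideVec θ t.a + sideVec θ t.b)}

/-- `T` is a rhombic tiling of `X(w)`: the tiles cover exactly `X(w)`, distinct tiles have disjoint
interiors, and the tiling is discrete: any two among the edges of the tiles and the sides of `X(w)`
that have more than one point in common coincide. -/
structure IsRhombicTiling (θ : Fin n → ℝ) (w : Equiv.Perm (Fin n)) (T : Finset (Rhombus n)) :
    Prop where
  cover : ⋃ t ∈ T, t.carrier θ = region θ w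
  disjoint : ∀ t ∈ T, ∀ t' ∈ T, t ≠ t' →
    Disjoint (interior (t.carrier θ)) (interior (t'.carrier θ))
  edge_to_edge :
    ∀ e ∈ (⋃ t ∈ T, t.edges θ) ∪ leftSides θ ∪ rightSides θ w,
    ∀ e' ∈ (⋃ t ∈ T, t.edges θ) ∪ leftSides θ ∪ rightSides θ w,
      (e ∩ e').Nontrivial → e = e'

/-- A left-perimeter tile includes two edges from the leftside boundary. -/
def IsLeftPerimeter (θ : Fin n → ℝ) (t : Rhombus n) : Prop :=
  (t.edges θ ∩ leftSides θ).Nontrivial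

/-- A right-perimeter tile includes two edges from the rightside boundary. -/
def IsRightPerimeter (θ : Fin n → ℝ) (w : Equiv.Perm (Fin n)) (t : Rhombus n) : Prop :=
  (t.edges θ ∩ rightSides θ w).Nontrivial

/-- The set of side-perimeter tiles of `T`: those that are left- or right-perimeter tiles. -/
def sidePerimeterTiles (θ : Fin n → ℝ) (w : Equiv.Perm (Fin n)) (T : Finset (Rhombus n)) :
    Set (Rhombus n) :=
  {t | t ∈ T ∧ (IsLeftPerimeter θ t ∨ IsRightPerimeter θ w t)}

end Elnitsky

end

noncomputable section

namespace Elnitsky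

open Filter Topology

variable {n : ℕ}

/-! ### Side vectors -/

/-! A downward path from the top to the bottom vertex is recorded by the permutation of labels along
it. A rhombus glued to the right of two consecutive sides of the path exchanges two adjacent labels
(`flip`). Rhombic tilings of X(w) therefore correspond to chains of adjacent exchanges from the
identity to w, each creating an inversion.

Both directions of this dictionary are needed. From a tiling to a chain: the first side where the
left path leaves the right one is an upper left edge of a tile, and walking down from there meets a
tile resting on two consecutive sides of the left path (`exists_flipTile_mem`); removing it leaves a
tiling between the exchanged path and w (`IsTilingBetween.erase`). From a chain to a tiling: as long
as some inversion of w is missing, an adjacent one can be created (`InvLE.exists_flip`), and the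
corresponding rhombus can be glued on (`IsPartialTiling.insert_flipTile`,
`IsPartialTiling.exists_extension`).

A left-perimeter tile is a possible first exchange, so it sits at a descent of the inverse of w; a
right-perimeter tile is a possible last exchange and sits at a descent of w. Every tiling has at
least one tile of each kind, and no tile is of both kinds, because a contiguous polygon has no inner
vertex common to its two boundaries. Two tiles of the same kind in one tiling cannot sit at
neighbouring positions, since they would overlap at a common side. If neither w nor its inverse has
two descents at distance two or more, each tiling thus has exactly two side-perimeter tiles. If one
of them has two such descents, the two exchanges are independent, and some tiling contains both
tiles together with a third one on the opposite boundary.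

It remains to find the permutations without distant descents (`exists_form_of_noDistantDescents`).
The places of the extreme values and the values at the extreme places yield descents of w and of its
inverse; the hypothesis makes the stretches between them monotone, and counting forces these to be
runs of consecutive integers, leaving at most one free entry. -/

lemma sideVec_im_neg {θ : Fin n → ℝ} (hθ : IsSideDirections θ) (i : Fin n) :
    (sideVec θ i).im < 0 := by
  obtain ⟨h1, h2⟩ := hθ.downward i
  have h := Real.sin_pos_of_pos_of_lt_pi (x := θ i - Real.pi) (by linarith) (by linarith)
  rw [Real.sin_sub_pi] at h
  change Real.sin (θ i) < 0
  linarith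

/-- The determinant of two vectors of the plane. -/
def det (z z' : ℂ) : ℝ := z.re * z'.im - z.im * z'.re

/-- The determinant is the sine of the angle from the first direction to the second, which lies
strictly between 0 and π because all directions point into the open lower half-plane. -/
lemma det_pos {θ : Fin n → ℝ} (hθ : IsSideDirections θ) {a b : Fin n} (hab : a < b) :
    0 < det (sideVec θ a) (sideVec θ b) := by
  have h1 := hθ.strictMono hab
  have h2 := hθ.downward a
  have h3 := hθ.downward b
  have h := Real.sin_pos_of_pos_of_lt_pi (x := θ b - θ a) (by linarith)
    (by linarith [h2.1, h3.2])
  rw [Real.sin_sub] at h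
  simp only [det, sideVec]
  linarith

lemma det_ne_zero {θ : Fin n → ℝ} (hθ : IsSideDirections θ) {a b : Fin n} (hab : a ≠ b) :
    det (sideVec θ a) (sideVec θ b) ≠ 0 := by
  rcases lt_or_gt_of_ne hab with h | h
  · exact (det_pos hθ h).ne'
  · have := det_pos hθ h
    simp only [det] at this ⊢
    intro h0
    linarith

lemma sideVec_injective {θ : Fin n → ℝ} (hθ : IsSideDirections θ) :
    Function.Injective (sideVec θ) := by
  intro a b hab
  by_contra hne
  apply det_ne_zero hθ hne
  rw [hab, det]
  ring

lemma mem_segment_sideVec {p s z : ℂ} :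
    z ∈ segment ℝ p (p + s) ↔ ∃ t ∈ Set.Icc (0 : ℝ) 1, z = p + t • s := by
  rw [segment_eq_image']
  simp only [Set.mem_image, add_sub_cancel_left]
  exact ⟨fun ⟨t, h, e⟩ => ⟨t, h, e.symm⟩, fun ⟨t, h, e⟩ => ⟨t, h, e.symm⟩⟩

/-- All side vectors point strictly downwards, so a segment determines its upper endpoint, and then
its vector. Through this, edge-to-edge contact becomes equality of vertices and labels. -/
lemma segment_sideVec_inj {θ : Fin n → ℝ} (hθ : IsSideDirections θ) {p q : ℂ} {a b : Fin n}
    (h : segment ℝ p (p + sideVec θ a) = segment ℝ q (q + sideVec θ b)) : p = q ∧ a = b := by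
  have ha := sideVec_im_neg hθ a
  have hb := sideVec_im_neg hθ b
  have hp : p ∈ segment ℝ q (q + sideVec θ b) := h ▸ left_mem_segment ℝ _ _
  have hq : q ∈ segment ℝ p (p + sideVec θ a) := h ▸ left_mem_segment ℝ _ _
  have hp' : p + sideVec θ a ∈ segment ℝ q (q + sideVec θ b) := h ▸ right_mem_segment ℝ _ _
  have hq' : q + sideVec θ b ∈ segment ℝ p (p + sideVec θ a) := h ▸ right_mem_segment ℝ _ _
  rw [mem_segment_sideVec] at hp hq hp' hq'
  obtain ⟨t, ht, hp⟩ := hp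
  obtain ⟨t', ht', hq⟩ := hq
  obtain ⟨x, hx, hp'⟩ := hp'
  obtain ⟨x', hx', hq'⟩ := hq'
  have e1 := congrArg Complex.im hp
  have e2 := congrArg Complex.im hq
  simp only [Complex.add_im, Complex.smul_im, smul_eq_mul] at e1 e2
  have ht0 : t = 0 := by
    have : t * (sideVec θ b).im = 0 := by nlinarith [ht.1, ht'.1]
    rcases mul_eq_zero.1 this with h | h
    · exact h
    · exact absurd h hb.ne
  have hpq : p = q := by rw [hp, ht0]; simp
  subst hpq
  refine ⟨rfl, sideVec_injective hθ ?_⟩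
  have e3 : sideVec θ a = x • sideVec θ b := add_left_cancel hp'
  have e4 : sideVec θ b = x' • sideVec θ a := add_left_cancel hq'
  have e5 := congrArg Complex.im e3
  have e6 := congrArg Complex.im e4
  simp only [Complex.smul_im, smul_eq_mul] at e5 e6
  have : x = 1 := by
    have h1 : (sideVec θ b).im ≤ (sideVec θ a).im := by nlinarith [hx.1, hx.2]
    have h2 : (sideVec θ a).im ≤ (sideVec θ b).im := by nlinarith [hx'.1, hx'.2]
    have h3 : (1 - x) * (sideVec θ b).im = 0 := by linarith
    rcases mul_eq_zero.1 h3 with h | h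
    · linarith
    · exact absurd h hb.ne
  rw [e3, this, one_smul]

/-! ### Downward paths -/

lemma pathVertex_zero (θ : Fin n → ℝ) (u : Equiv.Perm (Fin n)) : pathVertex θ u 0 = 0 := by
  simp [pathVertex]

lemma pathVertex_succ (θ : Fin n → ℝ) (u : Equiv.Perm (Fin n)) {j : ℕ} (hj : j < n) :
    pathVertex θ u (j + 1) = pathVertex θ u j + sideVec θ (u ⟨j, hj⟩) := by
  have : Finset.univ.filter (fun k : Fin n => (k : ℕ) < j + 1) =
      insert ⟨j, hj⟩ (Finset.univ.filter (fun k : Fin n => (k : ℕ) < j)) := by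
    ext k
    simp only [Finset.mem_filter, Finset.mem_univ, true_and, Finset.mem_insert, Fin.ext_iff]
    omega
  rw [pathVertex, this, Finset.sum_insert (by simp), add_comm, pathVertex]

lemma pathVertex_last (θ : Fin n → ℝ) (u : Equiv.Perm (Fin n)) :
    pathVertex θ u n = ∑ i, sideVec θ i := by
  rw [pathVertex, Finset.filter_true_of_mem (by simp)]
  exact Equiv.sum_comp u (sideVec θ)

lemma pathSide_eq (θ : Fin n → ℝ) (u : Equiv.Perm (Fin n)) {j : ℕ} (hj : j < n) :
    pathSide θ u ⟨j, hj⟩ =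
      segment ℝ (pathVertex θ u j) (pathVertex θ u j + sideVec θ (u ⟨j, hj⟩)) := by
  rw [pathSide]
  simp only
  rw [pathVertex_succ θ u hj]

lemma pathVertex_im_antitone {θ : Fin n → ℝ} (hθ : IsSideDirections θ)
    (u : Equiv.Perm (Fin n)) : Antitone fun j => (pathVertex θ u j).im := by
  intro i j hij
  simp only [pathVertex, Complex.im_sum]
  rw [← neg_le_neg_iff, ← Finset.sum_neg_distrib, ← Finset.sum_neg_distrib]
  apply Finset.sum_le_sum_of_subset_of_nonneg
  · intro k hk
    simp only [Finset.mem_filter, Finset.mem_univ, true_and] at hk ⊢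
    omega
  · intro k _ _
    linarith [sideVec_im_neg hθ (u k)]

/-- The real part of the point of the path `u` at height `y`. -/
def pathX (θ : Fin n → ℝ) (u : Equiv.Perm (Fin n)) (y : ℝ) : ℝ :=
  ∑ j : Fin n, max 0 (min 1 ((y - (pathVertex θ u j).im) / (sideVec θ (u j)).im)) *
    (sideVec θ (u j)).re

lemma continuous_pathX (θ : Fin n → ℝ) (u : Equiv.Perm (Fin n)) : Continuous (pathX θ u) := by
  unfold pathX
  fun_prop

/-- At a height on side `j`, the clamped fraction in `pathX` is 1 for the earlier sides, 0 for the
later ones and `t` for side `j` itself. -/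
lemma pathX_side {θ : Fin n → ℝ} (hθ : IsSideDirections θ) (u : Equiv.Perm (Fin n)) {j : ℕ}
    (hj : j < n) {t : ℝ} (ht : t ∈ Set.Icc (0 : ℝ) 1) :
    pathX θ u ((pathVertex θ u j).im + t * (sideVec θ (u ⟨j, hj⟩)).im) =
      (pathVertex θ u j).re + t * (sideVec θ (u ⟨j, hj⟩)).re := by
  have hs := sideVec_im_neg hθ (u ⟨j, hj⟩)
  have hanti := pathVertex_im_antitone hθ u
  have hre : (pathVertex θ u j).re =
      ∑ k : Fin n, if (k : ℕ) < j then (sideVec θ (u k)).re else 0 := by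
    rw [pathVertex, Complex.re_sum, Finset.sum_filter]
  rw [← sub_eq_iff_eq_add', hre, pathX, ← Finset.sum_sub_distrib,
    Finset.sum_eq_single ⟨j, hj⟩]
  · simp only [lt_irrefl, if_false, sub_zero]
    rw [add_sub_cancel_left, mul_div_cancel_right₀ _ hs.ne, min_eq_right ht.2,
      max_eq_right ht.1]
  · intro k _ hk
    have hk' : (k : ℕ) ≠ j := fun h => hk (Fin.ext h)
    have hsk := sideVec_im_neg hθ (u k)
    have hvk := pathVertex_succ θ u k.2
    rcases lt_or_gt_of_ne hk' with h | h
    · rw [if_pos h]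
      have h1 : (pathVertex θ u j).im ≤ (pathVertex θ u (k + 1)).im := hanti h
      rw [hvk, Complex.add_im] at h1
      simp only [Fin.eta] at h1
      rw [min_eq_left, max_eq_right zero_le_one, one_mul, sub_self]
      rw [le_div_iff_of_neg hsk]
      nlinarith [ht.1, ht.2]
    · rw [if_neg (by omega)]
      have h1 : (pathVertex θ u k).im ≤ (pathVertex θ u (j + 1)).im := hanti h
      rw [pathVertex_succ θ u hj, Complex.add_im] at h1
      rw [max_eq_left, zero_mul, sub_zero]
      apply (min_le_right _ _).trans
      apply div_nonpos_of_nonneg_of_nonpos _ hsk.le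
      nlinarith [ht.1, ht.2]
  · simp

/-- With `pathX_of_le`: above and below the polygon the value does not depend on the path. A strict
inequality between two paths therefore already confines the height to the polygon. -/
lemma pathX_of_nonneg {θ : Fin n → ℝ} (hθ : IsSideDirections θ) (u : Equiv.Perm (Fin n)) {y : ℝ}
    (hy : 0 ≤ y) : pathX θ u y = 0 := by
  apply Finset.sum_eq_zero
  intro k _
  have h1 : (pathVertex θ u k).im ≤ (pathVertex θ u 0).im :=
    pathVertex_im_antitone hθ u (Nat.zero_le _)
  rw [pathVertex_zero, Complex.zero_im] at h1
  rw [max_eq_left, zero_mul]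
  apply (min_le_right _ _).trans
  exact div_nonpos_of_nonneg_of_nonpos (by linarith) (sideVec_im_neg hθ (u k)).le

lemma pathX_of_le {θ : Fin n → ℝ} (hθ : IsSideDirections θ) (u : Equiv.Perm (Fin n)) {y : ℝ}
    (hy : y ≤ (∑ i, sideVec θ i).im) : pathX θ u y = (∑ i, sideVec θ i).re := by
  rw [← pathVertex_last θ u] at hy ⊢
  rw [pathX, pathVertex, Complex.re_sum, Finset.filter_true_of_mem (by simp)]
  apply Finset.sum_congr rfl
  intro k _
  have hsk := sideVec_im_neg hθ (u k)
  have h1 : (pathVertex θ u n).im ≤ (pathVertex θ u (k + 1)).im :=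
    pathVertex_im_antitone hθ u k.2
  rw [pathVertex_succ θ u k.2, Complex.add_im] at h1
  simp only [Fin.eta] at h1
  rw [min_eq_left, max_eq_right zero_le_one, one_mul]
  rw [le_div_iff_of_neg hsk]
  linarith

lemma exists_height_eq {θ : Fin n → ℝ} (hθ : IsSideDirections θ) (u : Equiv.Perm (Fin n)) {y : ℝ}
    (hy0 : y < 0) (hy : (∑ i, sideVec θ i).im ≤ y) :
    ∃ j, ∃ hj : j < n, ∃ t ∈ Set.Icc (0 : ℝ) 1,
      y = (pathVertex θ u j).im + t * (sideVec θ (u ⟨j, hj⟩)).im := by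
  have key : ∀ k, k ≤ n → (pathVertex θ u k).im ≤ y → ∃ j, ∃ hj : j < n,
      ∃ t ∈ Set.Icc (0 : ℝ) 1, y = (pathVertex θ u j).im + t * (sideVec θ (u ⟨j, hj⟩)).im := by
    intro k
    induction k with
    | zero =>
      intro _ h
      rw [pathVertex_zero, Complex.zero_im] at h
      linarith
    | succ k ih =>
      intro hk h
      by_cases h' : (pathVertex θ u k).im ≤ y
      · exact ih (by omega) h'
      · have hs := sideVec_im_neg hθ (u ⟨k, hk⟩)
        rw [pathVertex_succ θ u hk, Complex.add_im] at h
        refine ⟨k, hk, (y - (pathVertex θ u k).im) / (sideVec θ (u ⟨k, hk⟩)).im, ⟨?_, ?_⟩, ?_⟩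
        · exact div_nonneg_of_nonpos (by linarith) hs.le
        · rw [div_le_one_of_neg hs]
          linarith
        · rw [div_mul_cancel₀ _ hs.ne]
          ring
  exact key n le_rfl (by rwa [pathVertex_last])

lemma pathX_vertex {θ : Fin n → ℝ} (hθ : IsSideDirections θ) (u : Equiv.Perm (Fin n)) {j : ℕ}
    (hj : j ≤ n) : pathX θ u (pathVertex θ u j).im = (pathVertex θ u j).re := by
  rcases hj.lt_or_eq with h | rfl
  · simpa using pathX_side hθ u h (t := 0) (by simp)
  · rw [pathVertex_last, pathX_of_le hθ u le_rfl]

lemma mem_pathSides_iff {θ : Fin n → ℝ} (hθ : IsSideDirections θ) (hn : 0 < n)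
    (u : Equiv.Perm (Fin n)) {z : ℂ} :
    z ∈ ⋃₀ Set.range (pathSide θ u) ↔
      z.im ∈ Set.Icc (∑ i, sideVec θ i).im 0 ∧ z.re = pathX θ u z.im := by
  constructor
  · rintro ⟨_, ⟨⟨j, hj⟩, rfl⟩, hz⟩
    rw [pathSide_eq, mem_segment_sideVec] at hz
    obtain ⟨t, ht, rfl⟩ := hz
    have hs := sideVec_im_neg hθ (u ⟨j, hj⟩)
    simp only [Complex.add_im, Complex.smul_im, Complex.add_re, Complex.smul_re, smul_eq_mul]
    refine ⟨⟨?_, ?_⟩, (pathX_side hθ u hj ht).symm⟩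
    · have h1 : (pathVertex θ u n).im ≤ (pathVertex θ u (j + 1)).im :=
        pathVertex_im_antitone hθ u hj
      rw [pathVertex_last, pathVertex_succ θ u hj, Complex.add_im] at h1
      nlinarith [ht.1, ht.2]
    · have h1 : (pathVertex θ u j).im ≤ (pathVertex θ u 0).im :=
        pathVertex_im_antitone hθ u (Nat.zero_le _)
      rw [pathVertex_zero, Complex.zero_im] at h1
      nlinarith [ht.1, ht.2]
  · rintro ⟨⟨h1, h2⟩, h3⟩
    rcases h2.lt_or_eq with h2 | h2
    · obtain ⟨j, hj, t, ht, hy⟩ := exists_height_eq hθ u h2 h1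
      refine ⟨_, ⟨⟨j, hj⟩, rfl⟩, ?_⟩
      rw [pathSide_eq, mem_segment_sideVec]
      refine ⟨t, ht, Complex.ext ?_ ?_⟩
      · rw [h3, hy, pathX_side hθ u hj ht]
        simp
      · rw [hy]
        simp
    · refine ⟨_, ⟨⟨0, hn⟩, rfl⟩, ?_⟩
      have : z = pathVertex θ u 0 := by
        rw [pathVertex_zero]
        refine Complex.ext ?_ h2
        rw [h3, h2, pathX_of_nonneg hθ u le_rfl, Complex.zero_re]
      rw [pathSide_eq, this]
      exact left_mem_segment ℝ _ _

/-- From here on the region is handled through inequalities between the continuous functions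
`pathX`, not through the boundary curves. -/
lemma mem_region_iff {θ : Fin n → ℝ} (hθ : IsSideDirections θ) (hn : 0 < n)
    (w : Equiv.Perm (Fin n)) {z : ℂ} :
    z ∈ region θ w ↔ z.im ∈ Set.Icc (∑ i, sideVec θ i).im 0 ∧
      pathX θ 1 z.im ≤ z.re ∧ z.re ≤ pathX θ w z.im := by
  constructor
  · rintro ⟨p, hp, q, hq, e1, e2, h1, h2⟩
    rw [leftSides, mem_pathSides_iff hθ hn] at hp
    rw [rightSides, mem_pathSides_iff hθ hn] at hq
    rw [hp.2, e1] at h1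
    rw [hq.2, e2] at h2
    exact ⟨e1 ▸ hp.1, h1, h2⟩
  · rintro ⟨h0, h1, h2⟩
    refine ⟨⟨pathX θ 1 z.im, z.im⟩, ?_, ⟨pathX θ w z.im, z.im⟩, ?_, rfl, rfl, h1, h2⟩
    · rw [leftSides, mem_pathSides_iff hθ hn]
      exact ⟨h0, rfl⟩
    · rw [rightSides, mem_pathSides_iff hθ hn]
      exact ⟨h0, rfl⟩

/-! ### Coordinates of a rhombus -/

namespace Rhombus

/-- The coordinate along the edge with the smaller label. -/
def coordA (θ : Fin n → ℝ) (t : Rhombus n) (z : ℂ) : ℝ :=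
  det (z - t.top) (sideVec θ t.b) / det (sideVec θ t.a) (sideVec θ t.b)

/-- The coordinate along the edge with the larger label. -/
def coordB (θ : Fin n → ℝ) (t : Rhombus n) (z : ℂ) : ℝ :=
  det (sideVec θ t.a) (z - t.top) / det (sideVec θ t.a) (sideVec θ t.b)

variable {θ : Fin n → ℝ}

@[fun_prop]
lemma continuous_coordA (t : Rhombus n) : Continuous (t.coordA θ) := by
  unfold coordA det
  fun_prop

@[fun_prop]
lemma continuous_coordB (t : Rhombus n) : Continuous (t.coordB θ) := by
  unfold coordB det
  fun_prop

lemma coordA_apply (hθ : IsSideDirections θ) (t : Rhombus n) (x y : ℝ) :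
    t.coordA θ (t.top + x • sideVec θ t.a + y • sideVec θ t.b) = x := by
  rw [coordA, div_eq_iff (det_pos hθ t.a_lt_b).ne']
  simp only [det, Complex.add_re, Complex.add_im, Complex.sub_re, Complex.sub_im,
    Complex.smul_re, Complex.smul_im, smul_eq_mul]
  ring

lemma coordB_apply (hθ : IsSideDirections θ) (t : Rhombus n) (x y : ℝ) :
    t.coordB θ (t.top + x • sideVec θ t.a + y • sideVec θ t.b) = y := by
  rw [coordB, div_eq_iff (det_pos hθ t.a_lt_b).ne']
  simp only [det, Complex.add_re, Complex.add_im, Complex.sub_re, Complex.sub_im,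
    Complex.smul_re, Complex.smul_im, smul_eq_mul]
  ring

lemma eq_coord (hθ : IsSideDirections θ) (t : Rhombus n) (z : ℂ) :
    z = t.top + t.coordA θ z • sideVec θ t.a + t.coordB θ z • sideVec θ t.b := by
  have h := (det_pos hθ t.a_lt_b).ne'
  apply Complex.ext
  · simp only [Complex.add_re, Complex.smul_re, smul_eq_mul, coordA, coordB]
    field_simp
    simp only [det, Complex.sub_re, Complex.sub_im]
    ring
  · simp only [Complex.add_im, Complex.smul_im, smul_eq_mul, coordA, coordB]
    field_simp
    simp only [det, Complex.sub_re, Complex.sub_im]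
    ring

lemma mem_carrier_iff (hθ : IsSideDirections θ) (t : Rhombus n) (z : ℂ) :
    z ∈ t.carrier θ ↔
      t.coordA θ z ∈ Set.Icc (0 : ℝ) 1 ∧ t.coordB θ z ∈ Set.Icc (0 : ℝ) 1 := by
  constructor
  · rintro ⟨x, hx, y, hy, rfl⟩
    rw [coordA_apply hθ, coordB_apply hθ]
    exact ⟨hx, hy⟩
  · rintro ⟨hx, hy⟩
    exact ⟨_, hx, _, hy, t.eq_coord hθ z⟩

lemma isClosed_carrier (hθ : IsSideDirections θ) (t : Rhombus n) : IsClosed (t.carrier θ) := by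
  have : t.carrier θ = t.coordA θ ⁻¹' Set.Icc 0 1 ∩ t.coordB θ ⁻¹' Set.Icc 0 1 := by
    ext z
    exact t.mem_carrier_iff hθ z
  rw [this]
  exact (isClosed_Icc.preimage t.continuous_coordA).inter
    (isClosed_Icc.preimage t.continuous_coordB)

lemma mem_interior_of_coord (hθ : IsSideDirections θ) (t : Rhombus n) {z : ℂ}
    (hx : t.coordA θ z ∈ Set.Ioo (0 : ℝ) 1) (hy : t.coordB θ z ∈ Set.Ioo (0 : ℝ) 1) :
    z ∈ interior (t.carrier θ) := by
  refine mem_interior.2 ⟨t.coordA θ ⁻¹' Set.Ioo 0 1 ∩ t.coordB θ ⁻¹' Set.Ioo 0 1, ?_, ?_,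
    ⟨hx, hy⟩⟩
  · intro z' hz'
    exact (t.mem_carrier_iff hθ z').2
      ⟨Set.Ioo_subset_Icc_self hz'.1, Set.Ioo_subset_Icc_self hz'.2⟩
  · exact (isOpen_Ioo.preimage t.continuous_coordA).inter
      (isOpen_Ioo.preimage t.continuous_coordB)

/-- A move to the right lowers this coordinate and raises the other one. Hence the left boundary of
a rhombus is where `coordB` is 0 or `coordA` is 1, and the right boundary is where `coordA` is 0 or
`coordB` is 1. -/
lemma coordA_add_real (t : Rhombus n) (z : ℂ) (ε : ℝ) :
    t.coordA θ (z + ε) = t.coordA θ z +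
      ε * ((sideVec θ t.b).im / det (sideVec θ t.a) (sideVec θ t.b)) := by
  simp only [coordA, det, Complex.sub_re, Complex.sub_im, Complex.add_re, Complex.add_im,
    Complex.ofReal_re, Complex.ofReal_im]
  ring

lemma coordB_add_real (t : Rhombus n) (z : ℂ) (ε : ℝ) :
    t.coordB θ (z + ε) = t.coordB θ z -
      ε * ((sideVec θ t.a).im / det (sideVec θ t.a) (sideVec θ t.b)) := by
  simp only [coordB, det, Complex.sub_re, Complex.sub_im, Complex.add_re, Complex.add_im,
    Complex.ofReal_re, Complex.ofReal_im]
  ring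

/-- Points of the left boundary, other than the topmost and the bottommost one, see the interior
to their right. -/
lemma eventually_add_mem_interior (hθ : IsSideDirections θ) (t : Rhombus n) {z : ℂ}
    (hx0 : 0 < t.coordA θ z) (hx1 : t.coordA θ z ≤ 1) (hy0 : 0 ≤ t.coordB θ z)
    (hy1 : t.coordB θ z < 1) :
    ∀ᶠ ε : ℝ in 𝓝[>] 0, z + (ε : ℂ) ∈ interior (t.carrier θ) := by
  have hd := det_pos hθ t.a_lt_b
  have hα := div_neg_of_neg_of_pos (sideVec_im_neg hθ t.b) hd
  have hβ := div_neg_of_neg_of_pos (sideVec_im_neg hθ t.a) hd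
  have c1 : Continuous fun ε : ℝ => t.coordA θ (z + (ε : ℂ)) := by fun_prop
  have c2 : Continuous fun ε : ℝ => t.coordB θ (z + (ε : ℂ)) := by fun_prop
  have e1 : ∀ᶠ ε : ℝ in 𝓝 0, 0 < t.coordA θ (z + (ε : ℂ)) :=
    c1.continuousAt.eventually_const_lt (by simpa using hx0)
  have e2 : ∀ᶠ ε : ℝ in 𝓝 0, t.coordB θ (z + (ε : ℂ)) < 1 :=
    c2.continuousAt.eventually_lt_const (by simpa using hy1)
  filter_upwards [nhdsWithin_le_nhds e1, nhdsWithin_le_nhds e2, self_mem_nhdsWithin] with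
    ε h1 h2 h3
  have h3 : 0 < ε := h3
  refine t.mem_interior_of_coord hθ ⟨h1, ?_⟩ ⟨?_, h2⟩
  · rw [coordA_add_real]
    nlinarith
  · rw [coordB_add_real]
    nlinarith

/-- Points of the right boundary, other than the topmost and the bottommost one, see the interior
to their left. -/
lemma eventually_sub_mem_interior (hθ : IsSideDirections θ) (t : Rhombus n) {z : ℂ}
    (hx0 : 0 ≤ t.coordA θ z) (hx1 : t.coordA θ z < 1) (hy0 : 0 < t.coordB θ z)
    (hy1 : t.coordB θ z ≤ 1) :
    ∀ᶠ ε : ℝ in 𝓝[<] 0, z + (ε : ℂ) ∈ interior (t.carrier θ) := by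
  have hd := det_pos hθ t.a_lt_b
  have hα := div_neg_of_neg_of_pos (sideVec_im_neg hθ t.b) hd
  have hβ := div_neg_of_neg_of_pos (sideVec_im_neg hθ t.a) hd
  have c1 : Continuous fun ε : ℝ => t.coordA θ (z + (ε : ℂ)) := by fun_prop
  have c2 : Continuous fun ε : ℝ => t.coordB θ (z + (ε : ℂ)) := by fun_prop
  have e1 : ∀ᶠ ε : ℝ in 𝓝 0, t.coordA θ (z + (ε : ℂ)) < 1 :=
    c1.continuousAt.eventually_lt_const (by simpa using hx1)
  have e2 : ∀ᶠ ε : ℝ in 𝓝 0, 0 < t.coordB θ (z + (ε : ℂ)) :=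
    c2.continuousAt.eventually_const_lt (by simpa using hy0)
  filter_upwards [nhdsWithin_le_nhds e1, nhdsWithin_le_nhds e2, self_mem_nhdsWithin] with
    ε h1 h2 h3
  have h3 : ε < 0 := h3
  refine t.mem_interior_of_coord hθ ⟨?_, h1⟩ ⟨h2, ?_⟩
  · rw [coordA_add_real]
    nlinarith
  · rw [coordB_add_real]
    nlinarith

/-- A point of a rhombus from which one cannot move to the left inside the rhombus lies on the left
boundary. -/
lemma coord_eq_of_left_boundary (hθ : IsSideDirections θ) (t : Rhombus n) {z : ℂ}
    (hz : z ∈ t.carrier θ) (h : ∀ ε : ℝ, ε < 0 → z + (ε : ℂ) ∉ t.carrier θ) :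
    t.coordB θ z = 0 ∨ t.coordA θ z = 1 := by
  rw [mem_carrier_iff hθ] at hz
  by_contra hc
  push Not at hc
  obtain ⟨ε, h1, h2⟩ := ((t.eventually_sub_mem_interior hθ hz.1.1 (lt_of_le_of_ne hz.1.2 hc.2)
    (lt_of_le_of_ne hz.2.1 (Ne.symm hc.1)) hz.2.2).and self_mem_nhdsWithin).exists
  exact h ε h2 (interior_subset h1)

end Rhombus

variable {θ : Fin n → ℝ}

/-! ### Exchanging two consecutive sides of a path -/

/-- The path `u` with the sides in positions `j` and `j + 1` exchanged. -/
def flip (u : Equiv.Perm (Fin n)) {j : ℕ} (hj : j + 1 < n) : Equiv.Perm (Fin n) :=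
  u * Equiv.swap ⟨j, by omega⟩ ⟨j + 1, hj⟩

lemma flip_apply_fst (u : Equiv.Perm (Fin n)) {j : ℕ} (hj : j + 1 < n) :
    flip u hj ⟨j, by omega⟩ = u ⟨j + 1, hj⟩ := by
  simp [flip]

lemma flip_apply_snd (u : Equiv.Perm (Fin n)) {j : ℕ} (hj : j + 1 < n) :
    flip u hj ⟨j + 1, hj⟩ = u ⟨j, by omega⟩ := by
  simp [flip]

lemma flip_apply_of_ne (u : Equiv.Perm (Fin n)) {j : ℕ} (hj : j + 1 < n) (k : Fin n)
    (h1 : (k : ℕ) ≠ j) (h2 : (k : ℕ) ≠ j + 1) : flip u hj k = u k := by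
  rw [flip, Equiv.Perm.mul_apply, Equiv.swap_apply_of_ne_of_ne]
  · exact fun h => h1 (congrArg Fin.val h)
  · exact fun h => h2 (congrArg Fin.val h)

/-- The rhombus between a path and the path with two consecutive sides exchanged. -/
@[simps]
def flipTile (θ : Fin n → ℝ) (u : Equiv.Perm (Fin n)) {j : ℕ} (hj : j + 1 < n)
    (h : u ⟨j, by omega⟩ < u ⟨j + 1, hj⟩) : Rhombus n where
  top := pathVertex θ u j
  a := u ⟨j, by omega⟩
  b := u ⟨j + 1, hj⟩
  a_lt_b := h

lemma pathVertex_flip_of_le (θ : Fin n → ℝ) (u : Equiv.Perm (Fin n)) {j : ℕ} (hj : j + 1 < n)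
    {k : ℕ} (hk : k ≤ j) : pathVertex θ (flip u hj) k = pathVertex θ u k := by
  apply Finset.sum_congr rfl
  intro i hi
  simp only [Finset.mem_filter, Finset.mem_univ, true_and] at hi
  rw [flip_apply_of_ne u hj i (by omega) (by omega)]

lemma pathVertex_flip_of_ge (θ : Fin n → ℝ) (u : Equiv.Perm (Fin n)) {j : ℕ} (hj : j + 1 < n)
    {k : ℕ} (hk : j + 2 ≤ k) (hkn : k ≤ n) :
    pathVertex θ (flip u hj) k = pathVertex θ u k := by
  induction k, hk using Nat.le_induction with
  | base =>
    rw [pathVertex_succ θ _ hj, pathVertex_succ θ _ hj, pathVertex_succ θ _ (by omega : j < n),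
      pathVertex_succ θ _ (by omega : j < n), pathVertex_flip_of_le θ u hj le_rfl,
      flip_apply_fst, flip_apply_snd]
    ring
  | succ k hk ih =>
    rw [pathVertex_succ θ _ hkn, pathVertex_succ θ _ hkn, ih (by omega),
      flip_apply_of_ne u hj _ (by simp only; omega) (by simp only; omega)]

lemma pathSide_flip_of_ne (θ : Fin n → ℝ) (u : Equiv.Perm (Fin n)) {j : ℕ} (hj : j + 1 < n)
    (k : Fin n) (h1 : (k : ℕ) ≠ j) (h2 : (k : ℕ) ≠ j + 1) :
    pathSide θ (flip u hj) k = pathSide θ u k := by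
  rw [pathSide_eq, pathSide_eq, flip_apply_of_ne u hj k h1 h2]
  rcases lt_or_gt_of_ne h1 with h | h
  · rw [pathVertex_flip_of_le θ u hj h.le]
  · rw [pathVertex_flip_of_ge θ u hj (by omega) k.2.le]

lemma pathSide_mem_edges (θ : Fin n → ℝ) (u : Equiv.Perm (Fin n)) {j : ℕ} (hj : j + 1 < n)
    (h : u ⟨j, by omega⟩ < u ⟨j + 1, hj⟩) (k : Fin n) (hk : (k : ℕ) = j ∨ (k : ℕ) = j + 1) :
    pathSide θ u k ∈ (flipTile θ u hj h).edges θ := by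
  obtain ⟨k, hkn⟩ := k
  rcases hk with rfl | rfl
  · exact Or.inl (pathSide_eq θ u hkn)
  · rw [pathSide_eq, pathVertex_succ θ u (by omega : j < n)]
    exact Or.inr (Or.inr (Or.inl rfl))

lemma pathSide_flip_mem_edges (θ : Fin n → ℝ) (u : Equiv.Perm (Fin n)) {j : ℕ} (hj : j + 1 < n)
    (h : u ⟨j, by omega⟩ < u ⟨j + 1, hj⟩) (k : Fin n) (hk : (k : ℕ) = j ∨ (k : ℕ) = j + 1) :
    pathSide θ (flip u hj) k ∈ (flipTile θ u hj h).edges θ := by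
  obtain ⟨k, hkn⟩ := k
  rcases hk with rfl | rfl
  · rw [pathSide_eq, pathVertex_flip_of_le θ u hj le_rfl, flip_apply_fst]
    exact Or.inr (Or.inl rfl)
  · rw [pathSide_eq, pathVertex_succ θ _ (by omega : j < n), pathVertex_flip_of_le θ u hj le_rfl,
      flip_apply_fst, flip_apply_snd, add_right_comm]
    exact Or.inr (Or.inr (Or.inr rfl))

/-- Writing the point of the path in the basis of the two side vectors lets it be compared with
points of the rhombus. No order of the two labels is assumed, so the lemma applies to the exchanged
path as well. -/
lemma pathX_two_sides (hθ : IsSideDirections θ) (u : Equiv.Perm (Fin n)) {j : ℕ} (hj : j + 1 < n)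
    {h : ℝ} (h1 : (pathVertex θ u (j + 2)).im ≤ h) (h2 : h ≤ (pathVertex θ u j).im) :
    ∃ x ∈ Set.Icc (0 : ℝ) 1, ∃ y ∈ Set.Icc (0 : ℝ) 1, (y = 0 ∨ x = 1) ∧
      h = (pathVertex θ u j).im + x * (sideVec θ (u ⟨j, by omega⟩)).im +
        y * (sideVec θ (u ⟨j + 1, hj⟩)).im ∧
      pathX θ u h = (pathVertex θ u j).re + x * (sideVec θ (u ⟨j, by omega⟩)).re +
        y * (sideVec θ (u ⟨j + 1, hj⟩)).re := by
  have hj' : j < n := by omega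
  have ha := sideVec_im_neg hθ (u ⟨j, hj'⟩)
  have hb := sideVec_im_neg hθ (u ⟨j + 1, hj⟩)
  have v1 := pathVertex_succ θ u hj'
  have v2 := pathVertex_succ θ u hj
  by_cases hh : (pathVertex θ u (j + 1)).im ≤ h
  · have ht : (h - (pathVertex θ u j).im) / (sideVec θ (u ⟨j, hj'⟩)).im ∈ Set.Icc (0 : ℝ) 1 := by
      refine ⟨div_nonneg_of_nonpos (by linarith) ha.le, ?_⟩
      rw [div_le_one_of_neg ha]
      rw [v1, Complex.add_im] at hh
      linarith
    have e : h = (pathVertex θ u j).im + (h - (pathVertex θ u j).im) /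
        (sideVec θ (u ⟨j, hj'⟩)).im * (sideVec θ (u ⟨j, hj'⟩)).im := by
      rw [div_mul_cancel₀ _ ha.ne]
      ring
    refine ⟨_, ht, 0, by simp, Or.inl rfl, ?_, ?_⟩
    · linarith
    · have := pathX_side hθ u hj' ht
      rw [← e] at this
      linarith
  · push Not at hh
    have ht : (h - (pathVertex θ u (j + 1)).im) / (sideVec θ (u ⟨j + 1, hj⟩)).im ∈
        Set.Icc (0 : ℝ) 1 := by
      refine ⟨div_nonneg_of_nonpos (by linarith) hb.le, ?_⟩
      rw [div_le_one_of_neg hb]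
      rw [v2, Complex.add_im] at h1
      linarith
    have e : h = (pathVertex θ u (j + 1)).im + (h - (pathVertex θ u (j + 1)).im) /
        (sideVec θ (u ⟨j + 1, hj⟩)).im * (sideVec θ (u ⟨j + 1, hj⟩)).im := by
      rw [div_mul_cancel₀ _ hb.ne]
      ring
    refine ⟨1, by simp, _, ht, Or.inr rfl, ?_, ?_⟩
    · have e2 := congrArg Complex.im v1
      rw [Complex.add_im] at e2
      linarith
    · have := pathX_side hθ u hj ht
      rw [← e] at this
      have e2 := congrArg Complex.re v1
      rw [Complex.add_re] at e2
      linarith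

/-- At constant height, the horizontal displacement is the change of the second coordinate times the
determinant divided by the positive number `-(sideVec θ a).im`. -/
lemma re_le_re_of_same_height (hθ : IsSideDirections θ) {a b : Fin n} (hab : a < b)
    {x y x' y' : ℝ}
    (h : x * (sideVec θ a).im + y * (sideVec θ b).im =
      x' * (sideVec θ a).im + y' * (sideVec θ b).im) (hy : y ≤ y') :
    x * (sideVec θ a).re + y * (sideVec θ b).re ≤
      x' * (sideVec θ a).re + y' * (sideVec θ b).re := by
  have ha := sideVec_im_neg hθ a
  have hd := det_pos hθ hab
  rw [det] at hd
  have h1 : (sideVec θ a).im * ((x' - x) * (sideVec θ a).re + (y' - y) * (sideVec θ b).re) =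
      -((y' - y) * ((sideVec θ a).re * (sideVec θ b).im -
        (sideVec θ a).im * (sideVec θ b).re)) := by
    linear_combination (-(sideVec θ a).re) * h
  have h2 : (sideVec θ a).im * ((x' - x) * (sideVec θ a).re + (y' - y) * (sideVec θ b).re) ≤ 0 := by
    rw [h1]
    have := mul_nonneg (sub_nonneg.2 hy) hd.le
    linarith
  have h3 := nonneg_of_mul_nonpos_right h2 ha
  linarith

lemma le_of_left_coord (hθ : IsSideDirections θ) {a b : Fin n} {x y x' y' : ℝ}
    (h : x * (sideVec θ a).im + y * (sideVec θ b).im =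
      x' * (sideVec θ a).im + y' * (sideVec θ b).im)
    (hl : (y = 0 ∧ 0 ≤ y') ∨ (x = 1 ∧ x' ≤ 1)) : y ≤ y' := by
  rcases hl with ⟨rfl, hl⟩ | ⟨rfl, hl⟩
  · exact hl
  · have ha := sideVec_im_neg hθ a
    have hb := sideVec_im_neg hθ b
    by_contra hc
    push Not at hc
    nlinarith

lemma height_cases_flip (hθ : IsSideDirections θ) (u : Equiv.Perm (Fin n)) {j : ℕ}
    (hj : j + 1 < n) (h : ℝ) :
    (h ∈ Set.Icc (pathVertex θ u (j + 2)).im (pathVertex θ u j).im) ∨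
      pathX θ (flip u hj) h = pathX θ u h := by
  by_cases h0 : 0 ≤ h
  · right
    rw [pathX_of_nonneg hθ _ h0, pathX_of_nonneg hθ _ h0]
  by_cases h1 : h ≤ (∑ i, sideVec θ i).im
  · right
    rw [pathX_of_le hθ _ h1, pathX_of_le hθ _ h1]
  push Not at h0 h1
  obtain ⟨k, hk, t, ht, rfl⟩ := exists_height_eq hθ u h0 h1.le
  have hs := sideVec_im_neg hθ (u ⟨k, hk⟩)
  by_cases hk1 : k = j ∨ k = j + 1
  · left
    have e1 : (pathVertex θ u (j + 2)).im ≤ (pathVertex θ u (k + 1)).im :=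
      pathVertex_im_antitone hθ u (by omega)
    have e2 : (pathVertex θ u k).im ≤ (pathVertex θ u j).im :=
      pathVertex_im_antitone hθ u (by omega)
    rw [pathVertex_succ θ u hk, Complex.add_im] at e1
    constructor <;> nlinarith [ht.1, ht.2]
  · push Not at hk1
    right
    rw [pathX_side hθ u hk ht]
    have e1 : flip u hj ⟨k, hk⟩ = u ⟨k, hk⟩ := flip_apply_of_ne u hj _ hk1.1 hk1.2
    have e2 : pathVertex θ (flip u hj) k = pathVertex θ u k := by
      rcases lt_or_gt_of_ne hk1.1 with h | h
      · exact pathVertex_flip_of_le θ u hj h.le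
      · exact pathVertex_flip_of_ge θ u hj (by omega) hk.le
    have := pathX_side hθ (flip u hj) hk ht
    rw [e1, e2] at this
    exact this

/-- At the heights of the rhombus between `u` and `flip u hj`, the points of the two paths have
coordinates on the left and on the right boundary of the rhombus. -/
lemma pathX_flip_coords (hθ : IsSideDirections θ) (u : Equiv.Perm (Fin n)) {j : ℕ}
    (hj : j + 1 < n) {h : ℝ}
    (hh : h ∈ Set.Icc (pathVertex θ u (j + 2)).im (pathVertex θ u j).im) :
    ∃ x ∈ Set.Icc (0 : ℝ) 1, ∃ y ∈ Set.Icc (0 : ℝ) 1, (x = 0 ∨ y = 1) ∧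
      h = (pathVertex θ u j).im + x * (sideVec θ (u ⟨j, by omega⟩)).im +
        y * (sideVec θ (u ⟨j + 1, hj⟩)).im ∧
      pathX θ (flip u hj) h = (pathVertex θ u j).re + x * (sideVec θ (u ⟨j, by omega⟩)).re +
        y * (sideVec θ (u ⟨j + 1, hj⟩)).re := by
  have e1 := pathVertex_flip_of_ge θ u hj le_rfl hj
  have e2 := pathVertex_flip_of_le θ u hj le_rfl
  obtain ⟨x, hx, y, hy, h3, h4, h5⟩ := pathX_two_sides hθ (flip u hj) hj (h := h)
    (by rw [e1]; exact hh.1) (by rw [e2]; exact hh.2)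
  rw [e2, flip_apply_fst, flip_apply_snd] at h4 h5
  exact ⟨y, hy, x, hx, h3, by linarith, by linarith⟩

lemma pathX_le_flip (hθ : IsSideDirections θ) (u : Equiv.Perm (Fin n)) {j : ℕ} (hj : j + 1 < n)
    (hlt : u ⟨j, by omega⟩ < u ⟨j + 1, hj⟩) (h : ℝ) :
    pathX θ u h ≤ pathX θ (flip u hj) h := by
  rcases height_cases_flip hθ u hj h with hh | hh
  · obtain ⟨x, hx, y, hy, h3, h4, h5⟩ := pathX_two_sides hθ u hj hh.1 hh.2
    obtain ⟨x', hx', y', hy', h3', h4', h5'⟩ := pathX_flip_coords hθ u hj hh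
    have e := h4.symm.trans h4'
    have e' : x * (sideVec θ (u ⟨j, by omega⟩)).im + y * (sideVec θ (u ⟨j + 1, hj⟩)).im =
        x' * (sideVec θ (u ⟨j, by omega⟩)).im + y' * (sideVec θ (u ⟨j + 1, hj⟩)).im := by linarith
    have hyy : y ≤ y' := le_of_left_coord hθ e'
      (h3.imp (fun h => ⟨h, hy'.1⟩) (fun h => ⟨h, hx'.2⟩))
    have := re_le_re_of_same_height hθ hlt e' hyy
    rw [h5, h5']
    linarith
  · exact hh.ge

lemma height_mem_of_mem_flipTile (hθ : IsSideDirections θ) (u : Equiv.Perm (Fin n)) {j : ℕ}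
    (hj : j + 1 < n) (hlt : u ⟨j, by omega⟩ < u ⟨j + 1, hj⟩) {z : ℂ}
    (hz : z ∈ (flipTile θ u hj hlt).carrier θ) :
    z.im ∈ Set.Icc (pathVertex θ u (j + 2)).im (pathVertex θ u j).im := by
  obtain ⟨x, hx, y, hy, rfl⟩ := hz
  have ha := sideVec_im_neg hθ (u ⟨j, by omega⟩)
  have hb := sideVec_im_neg hθ (u ⟨j + 1, hj⟩)
  simp only [flipTile, Complex.add_im, Complex.smul_im, smul_eq_mul]
  rw [pathVertex_succ θ u hj, pathVertex_succ θ u (by omega : j < n), Complex.add_im,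
    Complex.add_im]
  constructor <;> nlinarith [hx.1, hx.2, hy.1, hy.2]

lemma flipTile_between (hθ : IsSideDirections θ) (u : Equiv.Perm (Fin n)) {j : ℕ}
    (hj : j + 1 < n) (hlt : u ⟨j, by omega⟩ < u ⟨j + 1, hj⟩) {z : ℂ}
    (hz : z ∈ (flipTile θ u hj hlt).carrier θ) :
    pathX θ u z.im ≤ z.re ∧ z.re ≤ pathX θ (flip u hj) z.im := by
  have hh := height_mem_of_mem_flipTile hθ u hj hlt hz
  obtain ⟨x, hx, y, hy, h3, h4, h5⟩ := pathX_two_sides hθ u hj hh.1 hh.2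
  obtain ⟨x', hx', y', hy', h3', h4', h5'⟩ := pathX_flip_coords hθ u hj hh
  obtain ⟨c, hc, d, hd, hz⟩ := hz
  have er := congrArg Complex.re hz
  have ei := congrArg Complex.im hz
  simp only [flipTile, Complex.add_im, Complex.smul_im, smul_eq_mul, Complex.add_re,
    Complex.smul_re] at er ei
  rw [h5, h5', er]
  have e1 : x * (sideVec θ (u ⟨j, by omega⟩)).im + y * (sideVec θ (u ⟨j + 1, hj⟩)).im =
      c * (sideVec θ (u ⟨j, by omega⟩)).im + d * (sideVec θ (u ⟨j + 1, hj⟩)).im := by linarith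
  have e2 : c * (sideVec θ (u ⟨j, by omega⟩)).im + d * (sideVec θ (u ⟨j + 1, hj⟩)).im =
      x' * (sideVec θ (u ⟨j, by omega⟩)).im + y' * (sideVec θ (u ⟨j + 1, hj⟩)).im := by linarith
  have hyy : y ≤ d := le_of_left_coord hθ e1
    (h3.imp (fun h => ⟨h, hd.1⟩) (fun h => ⟨h, hc.2⟩))
  have hyy' : d ≤ y' := by
    rcases h3' with rfl | rfl
    · have ha := sideVec_im_neg hθ (u ⟨j, by omega⟩)
      have hb := sideVec_im_neg hθ (u ⟨j + 1, hj⟩)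
      by_contra hcon
      push Not at hcon
      nlinarith [hc.1]
    · exact hd.2
  have := re_le_re_of_same_height hθ hlt e1 hyy
  have := re_le_re_of_same_height hθ hlt e2 hyy'
  constructor <;> linarith

/-- The point is a convex combination of the points of the two paths at its height, hence so are its
coordinates. Strictness places the height on the rhombus and permits division by the distance of the
paths. -/
lemma mem_flipTile (hθ : IsSideDirections θ) (u : Equiv.Perm (Fin n)) {j : ℕ}
    (hj : j + 1 < n) (hlt : u ⟨j, by omega⟩ < u ⟨j + 1, hj⟩) {z : ℂ}
    (h : pathX θ u z.im < pathX θ (flip u hj) z.im) (h1 : pathX θ u z.im ≤ z.re)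
    (h2 : z.re ≤ pathX θ (flip u hj) z.im) : z ∈ (flipTile θ u hj hlt).carrier θ := by
  have hh := (height_cases_flip hθ u hj z.im).resolve_right h.ne'
  obtain ⟨x, hx, y, hy, -, h4, h5⟩ := pathX_two_sides hθ u hj hh.1 hh.2
  obtain ⟨x', hx', y', hy', -, h4', h5'⟩ := pathX_flip_coords hθ u hj hh
  set L := pathX θ u z.im
  set R := pathX θ (flip u hj) z.im
  obtain ⟨c, hc0, hc1, hc⟩ : ∃ c, 0 ≤ c ∧ c ≤ 1 ∧ z.re = (1 - c) * L + c * R := by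
    refine ⟨(z.re - L) / (R - L), div_nonneg (by linarith) (by linarith), ?_, ?_⟩
    · rw [div_le_one (by linarith)]
      linarith
    · have : R - L ≠ 0 := by linarith
      field_simp
      ring
  refine ⟨(1 - c) * x + c * x', ⟨?_, ?_⟩, (1 - c) * y + c * y', ⟨?_, ?_⟩, Complex.ext ?_ ?_⟩
  · nlinarith [hx.1, hx'.1]
  · nlinarith [hx.2, hx'.2]
  · nlinarith [hy.1, hy'.1]
  · nlinarith [hy.2, hy'.2]
  · simp only [flipTile, Complex.smul_re, smul_eq_mul, Complex.add_re]
    rw [hc, h5, h5']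
    ring
  · simp only [flipTile, Complex.smul_im, smul_eq_mul, Complex.add_im]
    linear_combination (1 - c) * h4 + c * h4'

lemma mem_interior_flipTile (hθ : IsSideDirections θ) (u : Equiv.Perm (Fin n)) {j : ℕ}
    (hj : j + 1 < n) (hlt : u ⟨j, by omega⟩ < u ⟨j + 1, hj⟩) {z : ℂ}
    (h1 : pathX θ u z.im < z.re) (h2 : z.re < pathX θ (flip u hj) z.im) :
    z ∈ interior ((flipTile θ u hj hlt).carrier θ) := by
  have c1 := continuous_pathX θ u
  have c2 := continuous_pathX θ (flip u hj)
  refine mem_interior.2 ⟨{z | pathX θ u z.im < z.re} ∩ {z | z.re < pathX θ (flip u hj) z.im},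
    ?_, ?_, ⟨h1, h2⟩⟩
  · rintro z ⟨h1, h2⟩
    exact mem_flipTile hθ u hj hlt (lt_trans h1 h2) (le_of_lt h1) (le_of_lt h2)
  · exact (isOpen_lt (by fun_prop) (by fun_prop)).inter (isOpen_lt (by fun_prop) (by fun_prop))

/-! ### Tilings of the region between two paths -/

/-- `T` is a rhombic tiling of the region between the path `u` on the left and the path `w` on the
right. -/
structure IsTilingBetween (θ : Fin n → ℝ) (u w : Equiv.Perm (Fin n)) (T : Finset (Rhombus n)) :
    Prop where
  le : ∀ h, pathX θ u h ≤ pathX θ w h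
  subset : ∀ t ∈ T, ∀ z ∈ t.carrier θ, pathX θ u z.im ≤ z.re ∧ z.re ≤ pathX θ w z.im
  cover : ∀ z : ℂ, pathX θ u z.im < z.re → z.re < pathX θ w z.im → ∃ t ∈ T, z ∈ t.carrier θ
  disjoint : ∀ t ∈ T, ∀ t' ∈ T, t ≠ t' →
    Disjoint (interior (t.carrier θ)) (interior (t'.carrier θ))
  edge_to_edge :
    ∀ e ∈ (⋃ t ∈ T, t.edges θ) ∪ Set.range (pathSide θ u) ∪ Set.range (pathSide θ w),
    ∀ e' ∈ (⋃ t ∈ T, t.edges θ) ∪ Set.range (pathSide θ u) ∪ Set.range (pathSide θ w),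
      (e ∩ e').Nontrivial → e = e'

/-- Two tiles having the same point on their left boundaries, other than as topmost or bottommost
point, coincide. -/
lemma eq_of_left_boundary (hθ : IsSideDirections θ) {T : Finset (Rhombus n)}
    (hT : ∀ t ∈ T, ∀ t' ∈ T, t ≠ t' →
      Disjoint (interior (t.carrier θ)) (interior (t'.carrier θ)))
    {t t' : Rhombus n} (ht : t ∈ T) (ht' : t' ∈ T) {z : ℂ}
    (h : 0 < t.coordA θ z ∧ t.coordA θ z ≤ 1 ∧ 0 ≤ t.coordB θ z ∧ t.coordB θ z < 1)
    (h' : 0 < t'.coordA θ z ∧ t'.coordA θ z ≤ 1 ∧ 0 ≤ t'.coordB θ z ∧ t'.coordB θ z < 1) :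
    t = t' := by
  by_contra hne
  obtain ⟨ε, h1, h2⟩ := ((t.eventually_add_mem_interior hθ h.1 h.2.1 h.2.2.1 h.2.2.2).and
    (t'.eventually_add_mem_interior hθ h'.1 h'.2.1 h'.2.2.1 h'.2.2.2)).exists
  exact Set.disjoint_left.1 (hT t ht t' ht' hne) h1 h2

/-- Two tiles having the same point on their right boundaries, other than as topmost or bottommost
point, coincide. -/
lemma eq_of_right_boundary (hθ : IsSideDirections θ) {T : Finset (Rhombus n)}
    (hT : ∀ t ∈ T, ∀ t' ∈ T, t ≠ t' →
      Disjoint (interior (t.carrier θ)) (interior (t'.carrier θ)))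
    {t t' : Rhombus n} (ht : t ∈ T) (ht' : t' ∈ T) {z : ℂ}
    (h : 0 ≤ t.coordA θ z ∧ t.coordA θ z < 1 ∧ 0 < t.coordB θ z ∧ t.coordB θ z ≤ 1)
    (h' : 0 ≤ t'.coordA θ z ∧ t'.coordA θ z < 1 ∧ 0 < t'.coordB θ z ∧ t'.coordB θ z ≤ 1) :
    t = t' := by
  by_contra hne
  obtain ⟨ε, h1, h2⟩ := ((t.eventually_sub_mem_interior hθ h.1 h.2.1 h.2.2.1 h.2.2.2).and
    (t'.eventually_sub_mem_interior hθ h'.1 h'.2.1 h'.2.2.1 h'.2.2.2)).exists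
  exact Set.disjoint_left.1 (hT t ht t' ht' hne) h1 h2

/-- The side of `u` in position `j` is the upper left edge of `t`. -/
def IsUpperLeftAt (θ : Fin n → ℝ) (u : Equiv.Perm (Fin n)) {j : ℕ} (hj : j < n)
    (t : Rhombus n) : Prop :=
  t.top = pathVertex θ u j ∧ t.a = u ⟨j, hj⟩

/-- The side of `u` in position `j` is the lower left edge of `t`. -/
def IsLowerLeftAt (θ : Fin n → ℝ) (u : Equiv.Perm (Fin n)) {j : ℕ} (hj : j < n)
    (t : Rhombus n) : Prop :=
  t.top + sideVec θ t.a = pathVertex θ u j ∧ t.b = u ⟨j, hj⟩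

lemma Rhombus.coord_left_vertex (hθ : IsSideDirections θ) (t : Rhombus n) :
    t.coordA θ (t.top + sideVec θ t.a) = 1 ∧ t.coordB θ (t.top + sideVec θ t.a) = 0 := by
  have h1 := t.coordA_apply hθ 1 0
  have h2 := t.coordB_apply hθ 1 0
  simp only [one_smul, zero_smul, add_zero] at h1 h2
  exact ⟨h1, h2⟩

namespace IsTilingBetween

variable {u w : Equiv.Perm (Fin n)} {T : Finset (Rhombus n)}

/-- The left vertex of a tile lies strictly to the left of the right path. -/
lemma re_lt_of_left_vertex (hθ : IsSideDirections θ) (hT : IsTilingBetween θ u w T)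
    {t : Rhombus n} (ht : t ∈ T) :
    (t.top + sideVec θ t.a).re < pathX θ w (t.top + sideVec θ t.a).im := by
  obtain ⟨h1, h2⟩ := t.coord_left_vertex hθ
  obtain ⟨ε, h3, h4⟩ := ((t.eventually_add_mem_interior hθ (z := t.top + sideVec θ t.a)
    (by simp [h1]) (by simp [h1]) (by simp [h2]) (by simp [h2])).and self_mem_nhdsWithin).exists
  have h4 : 0 < ε := h4
  have h5 := (hT.subset t ht _ (interior_subset h3)).2
  simp only [Complex.add_im, Complex.ofReal_im, add_zero, Complex.add_re,
    Complex.ofReal_re] at h5 ⊢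
  linarith

/-- Points slightly to the right are covered, and a finite union of closed tiles is closed. The tile
found cannot extend to the left of the path, so the point is on its left boundary. -/
lemma exists_mem_of_left_path (hθ : IsSideDirections θ) (hT : IsTilingBetween θ u w T)
    {z : ℂ} (hz : z.re = pathX θ u z.im) (h : pathX θ u z.im < pathX θ w z.im) :
    ∃ t ∈ T, z ∈ t.carrier θ ∧ (t.coordB θ z = 0 ∨ t.coordA θ z = 1) := by
  have hclosed : IsClosed (⋃ t ∈ T, t.carrier θ) :=
    T.finite_toSet.isClosed_biUnion fun t _ => t.isClosed_carrier hθ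
  have hmem : z ∈ ⋃ t ∈ T, t.carrier θ := by
    have hc : Continuous fun ε : ℝ => z + (ε : ℂ) := by fun_prop
    have hlim : Tendsto (fun ε : ℝ => z + (ε : ℂ)) (𝓝[>] 0) (𝓝 z) := by
      have := hc.tendsto 0
      simp only [Complex.ofReal_zero, add_zero] at this
      exact this.mono_left nhdsWithin_le_nhds
    refine hclosed.mem_of_tendsto hlim ?_
    have hlt : ∀ᶠ ε : ℝ in 𝓝 0, z.re + ε < pathX θ w z.im := by
      have hc' : Continuous fun ε : ℝ => z.re + ε := by fun_prop
      exact hc'.continuousAt.eventually_lt_const (by simpa [hz] using h)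
    filter_upwards [nhdsWithin_le_nhds hlt, self_mem_nhdsWithin] with ε h1 h2
    have h2 : 0 < ε := h2
    obtain ⟨t, ht, hzt⟩ := hT.cover (z + (ε : ℂ)) (by simp [hz, h2]) (by simpa using h1)
    exact Set.mem_biUnion ht hzt
  simp only [Set.mem_iUnion] at hmem
  obtain ⟨t, ht, hzt⟩ := hmem
  refine ⟨t, ht, hzt, t.coord_eq_of_left_boundary hθ hzt ?_⟩
  intro ε hε hmem
  have := (hT.subset t ht _ hmem).1
  simp only [Complex.add_im, Complex.ofReal_im, add_zero, Complex.add_re,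
    Complex.ofReal_re] at this
  linarith

/-- If the right path is strictly to the right of the left one just below the upper endpoint of a
side of the left path, then that side is an edge of a tile. -/
lemma exists_tile_at_side (hθ : IsSideDirections θ) (hT : IsTilingBetween θ u w T) {j : ℕ}
    (hj : j < n)
    (h : ∀ᶠ s : ℝ in 𝓝[>] 0,
      pathX θ u ((pathVertex θ u j).im + s * (sideVec θ (u ⟨j, hj⟩)).im) <
        pathX θ w ((pathVertex θ u j).im + s * (sideVec θ (u ⟨j, hj⟩)).im)) :
    ∃ t ∈ T, IsUpperLeftAt θ u hj t ∨ IsLowerLeftAt θ u hj t := by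
  set v := pathVertex θ u j with hv
  set s₀ := sideVec θ (u ⟨j, hj⟩) with hs₀
  have hs := sideVec_im_neg hθ (u ⟨j, hj⟩)
  have h1 : ∀ᶠ s : ℝ in 𝓝[>] 0, s ≤ 1 := nhdsWithin_le_nhds (eventually_le_nhds one_pos)
  obtain ⟨δ, hδ, hsub⟩ := mem_nhdsGT_iff_exists_Ioo_subset.1 (h.and h1)
  have hδ : 0 < δ := hδ
  -- The Boolean records which left edge of the tile carries the point: `true` for the upper one,
  -- `false` for the lower one.
  have key : ∀ s ∈ Set.Ioo 0 δ, ∃ q ∈ T ×ˢ (Finset.univ : Finset Bool),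
      v + s • s₀ ∈ q.1.carrier θ ∧ (if q.2 then q.1.coordB θ (v + s • s₀) = 0
        else q.1.coordA θ (v + s • s₀) = 1) := by
    intro s hs'
    obtain ⟨h2, h3⟩ := hsub hs'
    obtain ⟨t, ht, h4, h5⟩ := hT.exists_mem_of_left_path hθ (z := v + s • s₀)
      (by
        have := pathX_side hθ u hj ⟨hs'.1.le, h3⟩
        simp only [Complex.add_im, Complex.smul_im, smul_eq_mul, Complex.add_re, Complex.smul_re]
        exact this.symm)
      (by simpa using h2)
    rcases h5 with h5 | h5
    · exact ⟨(t, true), by simp [ht], h4, by simpa using h5⟩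
    · exact ⟨(t, false), by simp [ht], h4, by simpa using h5⟩
  have : Nonempty (Rhombus n × Bool) :=
    (key (δ / 2) ⟨by linarith, by linarith⟩).elim fun q _ => ⟨q⟩
  choose! f hf1 hf2 using key
  -- Infinitely many points and finitely many pairs of a tile and an edge: two points lie on the
  -- same edge, which by the edge-to-edge condition is then the whole side.
  obtain ⟨s, hs1, s', hs2, hne, heq⟩ := (Set.Ioo_infinite hδ).exists_ne_map_eq_of_mapsTo
    (f := f) (t := (↑(T ×ˢ (Finset.univ : Finset Bool)) : Set (Rhombus n × Bool)))
    (fun s hs => hf1 s hs) (Finset.finite_toSet _)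
  have hmemside : ∀ s ∈ Set.Ioo 0 δ, v + s • s₀ ∈ pathSide θ u ⟨j, hj⟩ := by
    intro s hs
    rw [pathSide_eq, mem_segment_sideVec]
    exact ⟨s, ⟨hs.1.le, (hsub hs).2⟩, rfl⟩
  have hz : v + s • s₀ ≠ v + s' • s₀ := by
    intro e
    have := congrArg Complex.im e
    simp only [Complex.add_im, Complex.smul_im, smul_eq_mul, add_right_inj,
      mul_eq_mul_right_iff] at this
    exact this.elim hne hs.ne
  have g1 := hf2 s hs1
  have g2 := hf2 s' hs2
  rw [← heq] at g2
  have hq := hf1 s hs1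
  generalize f s = q at g1 g2 hq
  obtain ⟨t, c⟩ := q
  simp only [Finset.mem_product, Finset.mem_univ, and_true] at hq
  refine ⟨t, hq, ?_⟩
  have hside : pathSide θ u ⟨j, hj⟩ ∈ (⋃ t ∈ T, t.edges θ) ∪ Set.range (pathSide θ u) ∪
      Set.range (pathSide θ w) := Or.inl (Or.inr ⟨_, rfl⟩)
  cases c
  · right
    have hon : ∀ z ∈ t.carrier θ, t.coordA θ z = 1 →
        z ∈ segment ℝ (t.top + sideVec θ t.a) (t.top + sideVec θ t.a + sideVec θ t.b) := by
      intro z hz h0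
      rw [mem_segment_sideVec]
      refine ⟨_, ((t.mem_carrier_iff hθ z).1 hz).2, ?_⟩
      conv_lhs => rw [t.eq_coord hθ z, h0, one_smul]
    have := hT.edge_to_edge
      (segment ℝ (t.top + sideVec θ t.a) (t.top + sideVec θ t.a + sideVec θ t.b))
      (Or.inl (Or.inl (Set.mem_biUnion hq (Or.inr (Or.inr (Or.inl rfl)))))) _ hside
      ⟨_, ⟨hon _ g1.1 (by simpa using g1.2), hmemside _ hs1⟩, _,
        ⟨hon _ g2.1 (by simpa using g2.2), hmemside _ hs2⟩, hz⟩
    rw [pathSide_eq] at this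
    exact segment_sideVec_inj hθ this
  · left
    have hon : ∀ z ∈ t.carrier θ, t.coordB θ z = 0 →
        z ∈ segment ℝ t.top (t.top + sideVec θ t.a) := by
      intro z hz h0
      rw [mem_segment_sideVec]
      refine ⟨_, ((t.mem_carrier_iff hθ z).1 hz).1, ?_⟩
      conv_lhs => rw [t.eq_coord hθ z, h0, zero_smul, add_zero]
    have := hT.edge_to_edge (segment ℝ t.top (t.top + sideVec θ t.a))
      (Or.inl (Or.inl (Set.mem_biUnion hq (Or.inl rfl)))) _ hside
      ⟨_, ⟨hon _ g1.1 (by simpa using g1.2), hmemside _ hs1⟩, _,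
        ⟨hon _ g2.1 (by simpa using g2.2), hmemside _ hs2⟩, hz⟩
    rw [pathSide_eq] at this
    exact segment_sideVec_inj hθ this

/-- The first side in which the left path differs from the right one is the upper left edge of a
tile. -/
lemma exists_upperLeft (hθ : IsSideDirections θ) (hT : IsTilingBetween θ u w T) (huw : u ≠ w) :
    ∃ j, ∃ hj : j < n, ∃ t ∈ T, IsUpperLeftAt θ u hj t := by
  have hex : ∃ j, ∃ hj : j < n, u ⟨j, hj⟩ ≠ w ⟨j, hj⟩ := by
    by_contra hc
    push Not at hc
    exact huw (Equiv.ext fun i => hc i i.2)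
  classical
  obtain ⟨hj, hne⟩ := Nat.find_spec hex
  have hmin : ∀ k, k < Nat.find hex → ∀ hk : k < n, u ⟨k, hk⟩ = w ⟨k, hk⟩ := by
    intro k hk hkn
    by_contra hc
    exact Nat.find_min hex hk ⟨hkn, hc⟩
  generalize Nat.find hex = j at hj hne hmin
  have hv : pathVertex θ u j = pathVertex θ w j := by
    apply Finset.sum_congr rfl
    intro i hi
    simp only [Finset.mem_filter, Finset.mem_univ, true_and] at hi
    exact congrArg _ (hmin i hi i.2)
  have ha := sideVec_im_neg hθ (u ⟨j, hj⟩)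
  have hb := sideVec_im_neg hθ (w ⟨j, hj⟩)
  refine ⟨j, hj, ?_⟩
  obtain ⟨t, ht, h1 | h1⟩ := hT.exists_tile_at_side hθ hj (by
    -- A fraction `s` of the side of `u` and a fraction `s * r` of the side of `w` descend by the
    -- same amount. The bounds on `s` keep both points on their sides; the points differ because the
    -- two directions are not parallel.
    set r := (sideVec θ (u ⟨j, hj⟩)).im / (sideVec θ (w ⟨j, hj⟩)).im with hr
    have hr0 : 0 < r := div_pos_of_neg_of_neg ha hb
    have e1 : ∀ᶠ s : ℝ in 𝓝[>] 0, s ≤ 1 := nhdsWithin_le_nhds (eventually_le_nhds one_pos)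
    have e2 : ∀ᶠ s : ℝ in 𝓝[>] 0, s ≤ r⁻¹ :=
      nhdsWithin_le_nhds (eventually_le_nhds (inv_pos.2 hr0))
    filter_upwards [e1, e2, self_mem_nhdsWithin] with s h1 h2 h3
    have h3 : 0 < s := h3
    refine lt_of_le_of_ne (hT.le _) ?_
    have hrs : s * r ≤ 1 := by
      have := mul_le_mul_of_nonneg_right h2 hr0.le
      rwa [inv_mul_cancel₀ hr0.ne'] at this
    have hx1 := pathX_side hθ u hj ⟨h3.le, h1⟩
    have hx2 := pathX_side hθ w hj ⟨(mul_pos h3 hr0).le, hrs⟩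
    have e : s * r * (sideVec θ (w ⟨j, hj⟩)).im = s * (sideVec θ (u ⟨j, hj⟩)).im := by
      rw [mul_assoc, hr, div_mul_cancel₀ _ hb.ne]
    rw [← hv, e] at hx2
    rw [hx1, hx2]
    intro heq
    apply det_ne_zero hθ hne
    have e3 : s * ((sideVec θ (u ⟨j, hj⟩)).re - r * (sideVec θ (w ⟨j, hj⟩)).re) = 0 := by
      linarith
    have e4 := (mul_eq_zero.1 e3).resolve_left h3.ne'
    have e5 : r * (sideVec θ (w ⟨j, hj⟩)).im = (sideVec θ (u ⟨j, hj⟩)).im := by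
      rw [hr, div_mul_cancel₀ _ hb.ne]
    rw [det]
    linear_combination (sideVec θ (w ⟨j, hj⟩)).im * e4 + (sideVec θ (w ⟨j, hj⟩)).re * e5)
  · exact ⟨t, ht, h1⟩
  -- A tile with this side as lower left edge has its left vertex at the common vertex, hence on the
  -- right path.
  · exfalso
    have := hT.re_lt_of_left_vertex hθ ht
    rw [h1.1, hv, pathX_vertex hθ w hj.le] at this
    exact lt_irrefl _ this

/-- The left vertex of `t` is strictly to the left of `w`, so the next side of `u` also carries a
tile. If that side is a lower left edge, both tiles have the same left vertex, and two tiles with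
disjoint interiors cannot share it. -/
lemma upperLeft_step (hθ : IsSideDirections θ) (hT : IsTilingBetween θ u w T) {j : ℕ}
    (hj : j < n) {t : Rhombus n} (ht : t ∈ T) (htj : IsUpperLeftAt θ u hj t) :
    ∃ hj1 : j + 1 < n, (∃ hlt : u ⟨j, hj⟩ < u ⟨j + 1, hj1⟩, t = flipTile θ u hj1 hlt) ∨
      ∃ t' ∈ T, IsUpperLeftAt θ u hj1 t' := by
  have hlv := hT.re_lt_of_left_vertex hθ ht
  have hv : t.top + sideVec θ t.a = pathVertex θ u (j + 1) := by
    rw [pathVertex_succ θ u hj, htj.1, htj.2]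
  have hj1 : j + 1 < n := by
    by_contra hc
    obtain rfl : n = j + 1 := by omega
    rw [hv, pathVertex_last, pathX_of_le hθ w le_rfl] at hlv
    exact lt_irrefl _ hlv
  refine ⟨hj1, ?_⟩
  obtain ⟨t', ht', h1 | h1⟩ := hT.exists_tile_at_side hθ hj1 (by
    apply nhdsWithin_le_nhds
    have c1 := continuous_pathX θ u
    have c2 := continuous_pathX θ w
    apply ContinuousAt.eventually_lt
    · fun_prop
    · fun_prop
    · rw [zero_mul, add_zero, pathX_vertex hθ u hj1.le, ← hv]
      exact hlv)
  · exact Or.inr ⟨t', ht', h1⟩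
  · left
    have c1 := t.coord_left_vertex hθ
    have c2 := t'.coord_left_vertex hθ
    rw [h1.1, ← hv] at c2
    have heq : t = t' := by
      apply eq_of_left_boundary hθ hT.disjoint ht ht' (z := t.top + sideVec θ t.a)
      · rw [c1.1, c1.2]
        norm_num
      · rw [c2.1, c2.2]
        norm_num
    subst heq
    have hlt := t.a_lt_b
    rw [htj.2, h1.2] at hlt
    exact ⟨hlt, Rhombus.ext htj.1 htj.2 h1.2⟩

/-- A tiling between two different paths has a tile at two consecutive sides of the left path. -/
lemma exists_flipTile_mem (hθ : IsSideDirections θ) (hT : IsTilingBetween θ u w T)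
    (huw : u ≠ w) :
    ∃ j, ∃ hj : j + 1 < n, ∃ hlt : u ⟨j, by omega⟩ < u ⟨j + 1, hj⟩, flipTile θ u hj hlt ∈ T := by
  obtain ⟨j, hj, t, ht, htj⟩ := hT.exists_upperLeft hθ huw
  -- The number `m` bounds the remaining steps of the walk down the path, which cannot pass position
  -- `n`.
  obtain ⟨m, hm⟩ : ∃ m, n ≤ j + m := ⟨n, by omega⟩
  induction m generalizing j t with
  | zero => omega
  | succ m ih =>
    obtain ⟨hj1, ⟨hlt, rfl⟩ | ⟨t', ht', h'⟩⟩ := hT.upperLeft_step hθ hj ht htj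
    · exact ⟨j, hj1, hlt, ht⟩
    · exact ih (j + 1) hj1 t' ht' h' (by omega)

/-- Removing a tile at two consecutive sides of the left path. -/
lemma erase (hθ : IsSideDirections θ) (hT : IsTilingBetween θ u w T) {j : ℕ}
    (hj : j + 1 < n) (hlt : u ⟨j, by omega⟩ < u ⟨j + 1, hj⟩) (ht : flipTile θ u hj hlt ∈ T)
    [DecidableEq (Rhombus n)] :
    IsTilingBetween θ (flip u hj) w (T.erase (flipTile θ u hj hlt)) where
  le h := by
    rcases (pathX_le_flip hθ u hj hlt h).lt_or_eq with hh | hh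
    · exact (hT.subset _ ht ⟨pathX θ (flip u hj) h, h⟩
        (mem_flipTile hθ u hj hlt hh hh.le le_rfl)).2
    · rw [← hh]
      exact hT.le h
  subset t' ht' z hz := by
    obtain ⟨hne, ht'⟩ := Finset.mem_erase.1 ht'
    refine ⟨?_, (hT.subset t' ht' z hz).2⟩
    -- If `t'` reached to the left of the new path, moving from `z` slightly towards the centre `c`
    -- of `t'` would give an interior point of `t'` still left of that path. This point lies
    -- strictly right of `u`, as it can be moved left inside `t'`; so it is interior to the removed
    -- tile as well.
    by_contra hc
    push Not at hc
    set c : ℂ := t'.top + (1 / 2 : ℝ) • sideVec θ t'.a + (1 / 2 : ℝ) • sideVec θ t'.b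
    have c1 := continuous_pathX θ (flip u hj)
    have hev : ∀ᶠ ε : ℝ in 𝓝 0, (z + ε • (c - z)).re <
        pathX θ (flip u hj) (z + ε • (c - z)).im := by
      apply ContinuousAt.eventually_lt
      · fun_prop
      · fun_prop
      · simpa using hc
    have hev1 : ∀ᶠ ε : ℝ in 𝓝 0, ε < 1 := eventually_lt_nhds one_pos
    obtain ⟨ε, ⟨h1, h2⟩, h3⟩ := ((hev.and hev1).filter_mono
      nhdsWithin_le_nhds |>.and (self_mem_nhdsWithin (s := Set.Ioi (0 : ℝ)))).exists
    have h3 : 0 < ε := h3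
    set z' := z + ε • (c - z) with hz'
    obtain ⟨x, hx, y, hy, rfl⟩ := hz
    have hzc : z' = t'.top + (x + ε * (1 / 2 - x)) • sideVec θ t'.a +
        (y + ε * (1 / 2 - y)) • sideVec θ t'.b := by
      rw [hz']
      module
    have hint : z' ∈ interior (t'.carrier θ) := by
      apply t'.mem_interior_of_coord hθ
      · rw [hzc, t'.coordA_apply hθ]
        constructor <;> nlinarith [hx.1, hx.2]
      · rw [hzc, t'.coordB_apply hθ]
        constructor <;> nlinarith [hy.1, hy.2]
    have hleft : ∀ᶠ δ : ℝ in 𝓝 0, z' + (δ : ℂ) ∈ interior (t'.carrier θ) := by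
      have hcd : Continuous fun δ : ℝ => z' + (δ : ℂ) := by fun_prop
      exact hcd.continuousAt.eventually_mem (isOpen_interior.mem_nhds (by simpa using hint))
    obtain ⟨δ, h4, h5⟩ := ((hleft.filter_mono nhdsWithin_le_nhds).and
      (self_mem_nhdsWithin (s := Set.Iio (0 : ℝ)))).exists
    have h5 : δ < 0 := h5
    have h6 := (hT.subset t' ht' _ (interior_subset h4)).1
    simp only [Complex.add_im, Complex.ofReal_im, add_zero, Complex.add_re,
      Complex.ofReal_re] at h6
    exact Set.disjoint_left.1 (hT.disjoint _ ht _ ht' hne.symm)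
      (mem_interior_flipTile hθ u hj hlt (by linarith) h1) hint
  cover z h1 h2 := by
    obtain ⟨t', ht', hz⟩ := hT.cover z ((pathX_le_flip hθ u hj hlt _).trans_lt h1) h2
    refine ⟨t', Finset.mem_erase.2 ⟨?_, ht'⟩, hz⟩
    rintro rfl
    exact absurd (flipTile_between hθ u hj hlt hz).2 (not_le.2 h1)
  disjoint t₁ h₁ t₂ h₂ := hT.disjoint t₁ (Finset.mem_of_mem_erase h₁) t₂
    (Finset.mem_of_mem_erase h₂)
  edge_to_edge := by
    have hsub : (⋃ t ∈ T.erase (flipTile θ u hj hlt), t.edges θ) ∪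
        Set.range (pathSide θ (flip u hj)) ∪ Set.range (pathSide θ w) ⊆
        (⋃ t ∈ T, t.edges θ) ∪ Set.range (pathSide θ u) ∪ Set.range (pathSide θ w) := by
      rintro e ((he | ⟨k, rfl⟩) | he)
      · simp only [Set.mem_iUnion] at he
        obtain ⟨t', ht', he⟩ := he
        exact Or.inl (Or.inl (Set.mem_biUnion (Finset.mem_of_mem_erase ht') he))
      · by_cases hk : (k : ℕ) = j ∨ (k : ℕ) = j + 1
        · exact Or.inl (Or.inl (Set.mem_biUnion ht (pathSide_flip_mem_edges θ u hj hlt k hk)))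
        · push Not at hk
          rw [pathSide_flip_of_ne θ u hj k hk.1 hk.2]
          exact Or.inl (Or.inr ⟨k, rfl⟩)
      · exact Or.inr he
    intro e he e' he'
    exact hT.edge_to_edge e (hsub he) e' (hsub he')

end IsTilingBetween

/-! ### Inversions -/

/-- Every pair of labels inverted in `u` is inverted in `w`. -/
def InvLE (u w : Equiv.Perm (Fin n)) : Prop :=
  ∀ a b : Fin n, a < b → u.symm b < u.symm a → w.symm b < w.symm a

lemma InvLE.refl (u : Equiv.Perm (Fin n)) : InvLE u u := fun _ _ _ h => h

lemma InvLE.one_le (w : Equiv.Perm (Fin n)) : InvLE 1 w := fun _ _ h h' => absurd h h'.not_gt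

lemma flip_symm_apply (u : Equiv.Perm (Fin n)) {j : ℕ} (hj : j + 1 < n) (a : Fin n) :
    (flip u hj).symm a = Equiv.swap ⟨j, by omega⟩ ⟨j + 1, hj⟩ (u.symm a) := by
  rw [Equiv.symm_apply_eq, flip, Equiv.Perm.mul_apply, Equiv.swap_apply_self,
    Equiv.apply_symm_apply]

lemma flip_flip (u : Equiv.Perm (Fin n)) {j : ℕ} (hj : j + 1 < n) :
    flip (flip u hj) hj = u := by
  rw [flip, flip, mul_assoc, Equiv.swap_mul_self, mul_one]

/-- An adjacent transposition changes the order of no pair of positions except the exchanged one. -/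
lemma swap_lt_swap_iff {j : ℕ} (hj : j + 1 < n) {p q : Fin n}
    (h1 : ¬((p : ℕ) = j ∧ (q : ℕ) = j + 1)) (h2 : ¬((q : ℕ) = j ∧ (p : ℕ) = j + 1)) :
    Equiv.swap ⟨j, by omega⟩ ⟨j + 1, hj⟩ p < Equiv.swap ⟨j, by omega⟩ ⟨j + 1, hj⟩ q ↔ p < q := by
  simp only [Equiv.swap_apply_def, Fin.ext_iff, Fin.lt_def]
  split_ifs <;> simp only <;> omega

lemma flip_lt_flip_iff (u : Equiv.Perm (Fin n)) {j : ℕ} (hj : j + 1 < n) {a b : Fin n}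
    (h1 : ¬(a = u ⟨j, by omega⟩ ∧ b = u ⟨j + 1, hj⟩))
    (h2 : ¬(b = u ⟨j, by omega⟩ ∧ a = u ⟨j + 1, hj⟩)) :
    (flip u hj).symm a < (flip u hj).symm b ↔ u.symm a < u.symm b := by
  rw [flip_symm_apply, flip_symm_apply, swap_lt_swap_iff]
  · rintro ⟨h3, h4⟩
    exact h1 ⟨by rw [← Equiv.symm_apply_eq]; exact Fin.ext h3,
      by rw [← Equiv.symm_apply_eq]; exact Fin.ext h4⟩
  · rintro ⟨h3, h4⟩
    exact h2 ⟨by rw [← Equiv.symm_apply_eq]; exact Fin.ext h3,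
      by rw [← Equiv.symm_apply_eq]; exact Fin.ext h4⟩

lemma InvLE.of_flip {u w : Equiv.Perm (Fin n)} {j : ℕ} {hj : j + 1 < n}
    (hlt : u ⟨j, by omega⟩ < u ⟨j + 1, hj⟩) (h : InvLE (flip u hj) w) : InvLE u w := by
  intro a b hab hinv
  refine h a b hab ((flip_lt_flip_iff u hj ?_ ?_).2 hinv)
  · rintro ⟨rfl, rfl⟩
    exact absurd hab hlt.not_gt
  · rintro ⟨rfl, rfl⟩
    simp only [Equiv.symm_apply_apply, Fin.lt_def] at hinv
    omega

lemma InvLE.flip_le {u w : Equiv.Perm (Fin n)} {j : ℕ} {hj : j + 1 < n} (h : InvLE u w)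
    (hinv : w.symm (u ⟨j + 1, hj⟩) < w.symm (u ⟨j, by omega⟩)) : InvLE (flip u hj) w := by
  intro a b hab hinv'
  by_cases h1 : a = u ⟨j, by omega⟩ ∧ b = u ⟨j + 1, hj⟩
  · rw [h1.1, h1.2]
    exact hinv
  by_cases h2 : b = u ⟨j, by omega⟩ ∧ a = u ⟨j + 1, hj⟩
  · rw [h2.1, h2.2, flip_symm_apply, flip_symm_apply, Equiv.symm_apply_apply, Equiv.symm_apply_apply,
      Equiv.swap_apply_left, Equiv.swap_apply_right, Fin.lt_def] at hinv'
    simp only at hinv'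
    omega
  · exact h a b hab ((flip_lt_flip_iff u hj (fun hc => h2 hc) (fun hc => h1 hc)).1 hinv')

lemma symm_flip_lt (u : Equiv.Perm (Fin n)) {j : ℕ} (hj : j + 1 < n) :
    (flip u hj).symm (u ⟨j + 1, hj⟩) < (flip u hj).symm (u ⟨j, by omega⟩) := by
  rw [flip_symm_apply, flip_symm_apply, Equiv.symm_apply_apply, Equiv.symm_apply_apply,
    Equiv.swap_apply_left, Equiv.swap_apply_right, Fin.lt_def]
  simp

/-- A permutation of `Fin n` without descents is the identity. -/
lemma eq_one_of_forall_lt {v : Equiv.Perm (Fin n)}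
    (h : ∀ j, ∀ hj : j + 1 < n, v ⟨j, by omega⟩ < v ⟨j + 1, hj⟩) : v = 1 := by
  have hmono : StrictMono v := by
    intro a b hab
    obtain ⟨a, ha⟩ := a
    obtain ⟨b, hb⟩ := b
    replace hab : a + 1 ≤ b := hab
    induction b, hab using Nat.le_induction with
    | base => exact h a hb
    | succ b hab ih => exact (ih (by omega)).trans (h b hb)
  ext i
  have := Subsingleton.elim (hmono.orderIsoOfSurjective v v.surjective) (OrderIso.refl (Fin n))
  exact congrArg Fin.val (DFunLike.congr_fun this i)

/-- Otherwise `w⁻¹ * u` would have no descent: an ascent of `u` is not inverted in `w` by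
assumption, and a descent of `u` is an inversion of `w` by `InvLE`. -/
lemma InvLE.exists_flip {u w : Equiv.Perm (Fin n)} (h : InvLE u w) (huw : u ≠ w) :
    ∃ j, ∃ hj : j + 1 < n, u ⟨j, by omega⟩ < u ⟨j + 1, hj⟩ ∧
      w.symm (u ⟨j + 1, hj⟩) < w.symm (u ⟨j, by omega⟩) := by
  by_contra hc
  push Not at hc
  apply huw
  have : w⁻¹ * u = 1 := by
    apply eq_one_of_forall_lt
    intro j hj
    change w.symm (u ⟨j, _⟩) < w.symm (u ⟨j + 1, hj⟩)
    have hne : (⟨j, by omega⟩ : Fin n) ≠ ⟨j + 1, hj⟩ := by simp [Fin.ext_iff]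
    rcases lt_or_gt_of_ne (u.injective.ne hne) with h1 | h1
    · exact lt_of_le_of_ne (hc j hj h1) (w.symm.injective.ne (u.injective.ne hne))
    · apply h _ _ h1
      simp [Fin.lt_def]
  exact (inv_mul_eq_one.1 this).symm

/-- The number of pairs of labels inverted in `w` but not in `u`. -/
def inversionGap (u w : Equiv.Perm (Fin n)) : ℕ :=
  (Finset.univ.filter fun p : Fin n × Fin n =>
    p.1 < p.2 ∧ u.symm p.1 < u.symm p.2 ∧ w.symm p.2 < w.symm p.1).card

lemma inversionGap_flip_lt {u w : Equiv.Perm (Fin n)} {j : ℕ} {hj : j + 1 < n}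
    (hlt : u ⟨j, by omega⟩ < u ⟨j + 1, hj⟩)
    (hinv : w.symm (u ⟨j + 1, hj⟩) < w.symm (u ⟨j, by omega⟩)) :
    inversionGap (flip u hj) w < inversionGap u w := by
  apply Finset.card_lt_card
  rw [Finset.ssubset_iff_of_subset]
  · refine ⟨(u ⟨j, by omega⟩, u ⟨j + 1, hj⟩), ?_, ?_⟩
    · simp only [Finset.mem_filter, Finset.mem_univ, true_and]
      exact ⟨hlt, by simp [Fin.lt_def], hinv⟩
    · simp only [Finset.mem_filter, Finset.mem_univ, true_and]
      rintro ⟨-, h, -⟩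
      exact absurd h (symm_flip_lt u hj).not_gt
  · rintro ⟨a, b⟩ h
    simp only [Finset.mem_filter, Finset.mem_univ, true_and] at h ⊢
    refine ⟨h.1, (flip_lt_flip_iff u hj ?_ ?_).1 h.2.1, h.2.2⟩
    · rintro ⟨rfl, rfl⟩
      exact absurd h.2.1 (symm_flip_lt u hj).not_gt
    · rintro ⟨rfl, rfl⟩
      exact absurd h.1 hlt.not_gt

namespace IsTilingBetween

variable {u w : Equiv.Perm (Fin n)} {T : Finset (Rhombus n)}

/-- Peeling tiles off the left path is a chain of exchanges ending at `w`, and each exchange only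
adds inversions. -/
lemma invLE (hθ : IsSideDirections θ) (hT : IsTilingBetween θ u w T) : InvLE u w := by
  classical
  induction hm : T.card generalizing u T with
  | zero =>
    by_cases huw : u = w
    · exact huw ▸ InvLE.refl u
    · obtain ⟨j, hj, hlt, ht⟩ := hT.exists_flipTile_mem hθ huw
      rw [Finset.card_eq_zero.1 hm] at ht
      exact absurd ht (Finset.notMem_empty _)
  | succ m ih =>
    by_cases huw : u = w
    · exact huw ▸ InvLE.refl u
    · obtain ⟨j, hj, hlt, ht⟩ := hT.exists_flipTile_mem hθ huw
      exact (ih (hT.erase hθ hj hlt ht) (by rw [Finset.card_erase_of_mem ht, hm]; rfl)).of_flip hlt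

/-- A tiling between two different paths has a tile at two consecutive sides of the right path. -/
lemma exists_right_tile (hθ : IsSideDirections θ) (hT : IsTilingBetween θ u w T) (huw : u ≠ w) :
    ∃ t ∈ T, ∃ j, ∃ hj : j + 1 < n, t.top = pathVertex θ w j ∧ t.a = w ⟨j + 1, hj⟩ ∧
      t.b = w ⟨j, by omega⟩ := by
  classical
  induction hm : T.card generalizing u T with
  | zero =>
    obtain ⟨j, hj, hlt, ht⟩ := hT.exists_flipTile_mem hθ huw
    rw [Finset.card_eq_zero.1 hm] at ht
    exact absurd ht (Finset.notMem_empty _)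
  | succ m ih =>
    obtain ⟨j, hj, hlt, ht⟩ := hT.exists_flipTile_mem hθ huw
    -- The tile whose removal makes the left path equal to `w` is the one resting on the right path.
    by_cases huw' : flip u hj = w
    · subst huw'
      refine ⟨_, ht, j, hj, ?_, ?_, ?_⟩
      · rw [pathVertex_flip_of_le θ u hj le_rfl, flipTile_top]
      · rw [flip_apply_snd, flipTile_a]
      · rw [flip_apply_fst, flipTile_b]
    · obtain ⟨t, ht', h⟩ := ih (hT.erase hθ hj hlt ht) huw'
        (by rw [Finset.card_erase_of_mem ht, hm]; rfl)
      exact ⟨t, Finset.mem_of_mem_erase ht', h⟩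

end IsTilingBetween

/-! ### Construction of tilings -/

/-- The invariant of the construction of tilings by successive exchanges of sides of the right
boundary. -/
structure IsPartialTiling (θ : Fin n → ℝ) (w : Equiv.Perm (Fin n)) (T : Finset (Rhombus n)) :
    Prop where
  le : ∀ h, pathX θ 1 h ≤ pathX θ w h
  subset : ∀ t ∈ T, ∀ z ∈ t.carrier θ, pathX θ 1 z.im ≤ z.re ∧ z.re ≤ pathX θ w z.im
  height : ∀ t ∈ T, ∀ z ∈ t.carrier θ, z.im ∈ Set.Icc (∑ i, sideVec θ i).im 0
  cover : ∀ z : ℂ, pathX θ 1 z.im < z.re → z.re ≤ pathX θ w z.im → ∃ t ∈ T, z ∈ t.carrier θ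
  disjoint : ∀ t ∈ T, ∀ t' ∈ T, t ≠ t' →
    Disjoint (interior (t.carrier θ)) (interior (t'.carrier θ))
  edge_to_edge :
    ∀ e ∈ (⋃ t ∈ T, t.edges θ) ∪ leftSides θ ∪ rightSides θ w,
    ∀ e' ∈ (⋃ t ∈ T, t.edges θ) ∪ leftSides θ ∪ rightSides θ w,
      (e ∩ e').Nontrivial → e = e'
  left_side : ∀ i, pathSide θ 1 i ∈ rightSides θ w ∨ ∃ t ∈ T, pathSide θ 1 i ∈ t.edges θ

lemma mem_pathSide (hθ : IsSideDirections θ) {u : Equiv.Perm (Fin n)} {k : Fin n} {z : ℂ}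
    (hz : z ∈ pathSide θ u k) :
    z.re = pathX θ u z.im ∧ (pathVertex θ u (k + 1)).im ≤ z.im ∧ z.im ≤ (pathVertex θ u k).im := by
  have h1 := ((mem_pathSides_iff hθ k.pos u).1 ⟨_, ⟨k, rfl⟩, hz⟩).2
  rw [pathSide_eq, mem_segment_sideVec] at hz
  obtain ⟨t, ht, rfl⟩ := hz
  have hs := sideVec_im_neg hθ (u k)
  rw [pathVertex_succ θ u k.2]
  refine ⟨h1, ?_, ?_⟩
  · simp only [Complex.add_im, Complex.smul_im, smul_eq_mul, Fin.eta]
    nlinarith [ht.1, ht.2]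
  · simp only [Complex.add_im, Complex.smul_im, smul_eq_mul, Fin.eta]
    nlinarith [ht.1, ht.2]

lemma pathSide_inter_subsingleton (hθ : IsSideDirections θ) (u : Equiv.Perm (Fin n))
    {i k : Fin n} (hik : i ≠ k) : (pathSide θ u i ∩ pathSide θ u k).Subsingleton := by
  wlog h : i < k generalizing i k
  · rw [Set.inter_comm]
    exact this hik.symm (lt_of_le_of_ne (not_lt.1 h) hik.symm)
  have key : ∀ z ∈ pathSide θ u i ∩ pathSide θ u k, z.im = (pathVertex θ u k).im := by
    rintro z ⟨h1, h2⟩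
    have e1 := (mem_pathSide hθ h1).2.1
    have e2 := (mem_pathSide hθ h2).2.2
    have e3 : (pathVertex θ u k).im ≤ (pathVertex θ u (i + 1)).im :=
      pathVertex_im_antitone hθ u h
    linarith
  intro z hz z' hz'
  have e : z.im = z'.im := (key z hz).trans (key z' hz').symm
  refine Complex.ext ?_ e
  rw [(mem_pathSide hθ hz.1).1, (mem_pathSide hθ hz'.1).1, e]

/-- The start of the construction: with no tiles, `cover` is vacuous because it excludes the left
path. That path is covered only at the end, by means of `left_side`. -/
lemma isPartialTiling_one (hθ : IsSideDirections θ) : IsPartialTiling θ 1 ∅ where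
  le _ := le_rfl
  subset := by simp
  height := by simp
  cover z h1 h2 := absurd (h1.trans_le h2) (lt_irrefl _)
  disjoint := by simp
  edge_to_edge := by
    simp only [Finset.notMem_empty, Set.iUnion_of_empty, Set.iUnion_empty, Set.empty_union,
      leftSides, rightSides, Set.union_self]
    rintro _ ⟨i, rfl⟩ _ ⟨k, rfl⟩ h
    by_contra hne
    exact Set.not_nontrivial_iff.2
      (pathSide_inter_subsingleton hθ 1 (fun hik => hne (by rw [hik]))) h
  left_side i := Or.inl ⟨i, rfl⟩

lemma edges_flipTile (θ : Fin n → ℝ) (u : Equiv.Perm (Fin n)) {j : ℕ} (hj : j + 1 < n)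
    (hlt : u ⟨j, by omega⟩ < u ⟨j + 1, hj⟩) :
    (flipTile θ u hj hlt).edges θ = {pathSide θ u ⟨j, by omega⟩,
      pathSide θ (flip u hj) ⟨j, by omega⟩, pathSide θ u ⟨j + 1, hj⟩,
      pathSide θ (flip u hj) ⟨j + 1, hj⟩} := by
  have hj' : j < n := by omega
  rw [Rhombus.edges, pathSide_eq, pathSide_eq, pathSide_eq, pathSide_eq,
    pathVertex_succ θ u hj', pathVertex_succ θ (flip u hj) hj',
    pathVertex_flip_of_le θ u hj le_rfl, flip_apply_fst, flip_apply_snd]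
  simp only [flipTile_top, flipTile_a, flipTile_b]
  rw [add_right_comm _ (sideVec θ (u ⟨j + 1, hj⟩))]

lemma coord_unique (hθ : IsSideDirections θ) {a b : Fin n} (hab : a < b) {x y x' y' : ℝ}
    (h1 : x * (sideVec θ a).re + y * (sideVec θ b).re =
      x' * (sideVec θ a).re + y' * (sideVec θ b).re)
    (h2 : x * (sideVec θ a).im + y * (sideVec θ b).im =
      x' * (sideVec θ a).im + y' * (sideVec θ b).im) : x = x' ∧ y = y' := by
  have hd := (det_pos hθ hab).ne'
  rw [det] at hd
  constructor
  · apply mul_right_cancel₀ hd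
    linear_combination (sideVec θ b).im * h1 - (sideVec θ b).re * h2
  · apply mul_right_cancel₀ hd
    linear_combination (sideVec θ a).re * h2 - (sideVec θ a).im * h1

/-- A new side of the path `flip u hj` has at most one point weakly to the left of `u`. -/
lemma exists_eq_of_mem_pathSide_flip (hθ : IsSideDirections θ) (u : Equiv.Perm (Fin n)) {j : ℕ}
    (hj : j + 1 < n) (hlt : u ⟨j, by omega⟩ < u ⟨j + 1, hj⟩) (k : Fin n)
    (hk : (k : ℕ) = j ∨ (k : ℕ) = j + 1) :
    ∃ p, ∀ z ∈ pathSide θ (flip u hj) k, z.re ≤ pathX θ u z.im → z = p := by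
  have hj' : j < n := by omega
  have key : ∀ c ∈ Set.Icc (0 : ℝ) 1, ∀ d ∈ Set.Icc (0 : ℝ) 1, ∀ z : ℂ,
      z = pathVertex θ u j + c • sideVec θ (u ⟨j, hj'⟩) + d • sideVec θ (u ⟨j + 1, hj⟩) →
      z.re = pathX θ (flip u hj) z.im → z.re ≤ pathX θ u z.im → d = 0 ∨ c = 1 := by
    intro c hc d hd z hz h1 h2
    have h3 : z.re = pathX θ u z.im :=
      le_antisymm h2 ((pathX_le_flip hθ u hj hlt _).trans h1.ge)
    have hh := height_mem_of_mem_flipTile hθ u hj hlt (z := z) ⟨c, hc, d, hd, hz⟩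
    obtain ⟨x, hx, y, hy, h4, h5, h6⟩ := pathX_two_sides hθ u hj hh.1 hh.2
    rw [← h3] at h6
    have er := congrArg Complex.re hz
    have ei := congrArg Complex.im hz
    simp only [Complex.add_im, Complex.smul_im, smul_eq_mul, Complex.add_re,
      Complex.smul_re] at er ei
    obtain ⟨rfl, rfl⟩ := coord_unique hθ hlt (x := x) (y := y) (x' := c) (y' := d)
      (by linarith) (by linarith)
    exact h4
  obtain ⟨k, hkn⟩ := k
  rcases hk with rfl | rfl
  · refine ⟨pathVertex θ u k, fun z hz hle => ?_⟩
    have h1 := (mem_pathSide hθ hz).1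
    rw [pathSide_eq, mem_segment_sideVec, pathVertex_flip_of_le θ u hj le_rfl,
      flip_apply_fst] at hz
    obtain ⟨t, ht, hz⟩ := hz
    rcases key 0 (by simp) t ht z (by rw [hz, zero_smul, add_zero]) h1 hle with h | h
    · rw [hz, h, zero_smul, add_zero]
    · norm_num at h
  · refine ⟨pathVertex θ u (j + 2), fun z hz hle => ?_⟩
    have h1 := (mem_pathSide hθ hz).1
    rw [pathSide_eq, mem_segment_sideVec, pathVertex_succ θ _ hj',
      pathVertex_flip_of_le θ u hj le_rfl, flip_apply_fst, flip_apply_snd] at hz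
    obtain ⟨t, ht, hz⟩ := hz
    rcases key t ht 1 (by simp) z (by rw [hz, one_smul, add_right_comm]) h1 hle with h | h
    · norm_num at h
    · rw [hz, h, one_smul, pathVertex_succ θ u hj, pathVertex_succ θ u hj', add_right_comm]

lemma Rhombus.subset_carrier_of_mem_edges (t : Rhombus n) {e : Set ℂ}
    (he : e ∈ t.edges θ) : e ⊆ t.carrier θ := by
  intro z hz
  rcases he with rfl | rfl | rfl | rfl
  · rw [mem_segment_sideVec] at hz
    obtain ⟨x, hx, rfl⟩ := hz
    exact ⟨x, hx, 0, by simp, by simp⟩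
  · rw [mem_segment_sideVec] at hz
    obtain ⟨x, hx, rfl⟩ := hz
    exact ⟨0, by simp, x, hx, by simp⟩
  · rw [mem_segment_sideVec] at hz
    obtain ⟨x, hx, rfl⟩ := hz
    exact ⟨1, by simp, x, hx, by simp⟩
  · rw [add_right_comm, mem_segment_sideVec] at hz
    obtain ⟨x, hx, rfl⟩ := hz
    exact ⟨x, hx, 1, by simp, by rw [one_smul]; abel⟩

/-- The path `u` separates: old tiles and edges lie weakly to its left, the new tile weakly to its
right, and each new edge meets the left part in at most one point. -/
lemma IsPartialTiling.insert_flipTile (hθ : IsSideDirections θ) {u : Equiv.Perm (Fin n)}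
    {T : Finset (Rhombus n)} (hT : IsPartialTiling θ u T) {j : ℕ} (hj : j + 1 < n)
    (hlt : u ⟨j, by omega⟩ < u ⟨j + 1, hj⟩) [DecidableEq (Rhombus n)] :
    IsPartialTiling θ (flip u hj) (insert (flipTile θ u hj hlt) T) where
  le h := (hT.le h).trans (pathX_le_flip hθ u hj hlt h)
  subset t ht z hz := by
    rcases Finset.mem_insert.1 ht with rfl | ht
    · have := flipTile_between hθ u hj hlt hz
      exact ⟨(hT.le _).trans this.1, this.2⟩
    · have := hT.subset t ht z hz
      exact ⟨this.1, this.2.trans (pathX_le_flip hθ u hj hlt _)⟩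
  height t ht z hz := by
    rcases Finset.mem_insert.1 ht with rfl | ht
    · have h1 := height_mem_of_mem_flipTile hθ u hj hlt hz
      have h2 : (pathVertex θ u n).im ≤ (pathVertex θ u (j + 2)).im :=
        pathVertex_im_antitone hθ u hj
      have h3 : (pathVertex θ u j).im ≤ (pathVertex θ u 0).im :=
        pathVertex_im_antitone hθ u (Nat.zero_le _)
      rw [pathVertex_zero, Complex.zero_im] at h3
      rw [pathVertex_last] at h2
      exact ⟨h2.trans h1.1, h1.2.trans h3⟩
    · exact hT.height t ht z hz
  cover z h1 h2 := by
    by_cases h : z.re ≤ pathX θ u z.im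
    · obtain ⟨t, ht, hz⟩ := hT.cover z h1 h
      exact ⟨t, Finset.mem_insert_of_mem ht, hz⟩
    · push Not at h
      exact ⟨_, Finset.mem_insert_self _ _, mem_flipTile hθ u hj hlt (h.trans_le h2) h.le h2⟩
  disjoint := by
    have key : ∀ t ∈ T, Disjoint (interior (t.carrier θ))
        (interior ((flipTile θ u hj hlt).carrier θ)) := by
      intro t ht
      rw [Set.disjoint_left]
      intro z h1 h2
      have hc : Continuous fun ε : ℝ => z + (ε : ℂ) := by fun_prop
      have hev : ∀ᶠ ε : ℝ in 𝓝 0, z + (ε : ℂ) ∈ interior (t.carrier θ) :=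
        hc.continuousAt.eventually_mem (isOpen_interior.mem_nhds (by simpa using h1))
      obtain ⟨ε, h3, h4⟩ := ((hev.filter_mono nhdsWithin_le_nhds).and
        (self_mem_nhdsWithin (s := Set.Ioi (0 : ℝ)))).exists
      have h4 : 0 < ε := h4
      have h5 := (hT.subset t ht _ (interior_subset h3)).2
      have h6 := (flipTile_between hθ u hj hlt (interior_subset h2)).1
      simp only [Complex.add_im, Complex.ofReal_im, add_zero, Complex.add_re,
        Complex.ofReal_re] at h5
      linarith
    intro t ht t' ht' hne
    rcases Finset.mem_insert.1 ht with rfl | ht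
    · rcases Finset.mem_insert.1 ht' with rfl | ht'
      · exact absurd rfl hne
      · exact (key t' ht').symm
    · rcases Finset.mem_insert.1 ht' with rfl | ht'
      · exact key t ht
      · exact hT.disjoint t ht t' ht' hne
  edge_to_edge := by
    set E := (⋃ t ∈ T, t.edges θ) ∪ leftSides θ ∪ rightSides θ u with hE
    have hleft : ∀ e ∈ E, ∀ z ∈ e, z.re ≤ pathX θ u z.im := by
      rintro e ((he | ⟨k, rfl⟩) | ⟨k, rfl⟩) z hz
      · simp only [Set.mem_iUnion] at he
        obtain ⟨t, ht, he⟩ := he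
        exact (hT.subset t ht z (t.subset_carrier_of_mem_edges he hz)).2
      · exact (mem_pathSide hθ hz).1.le.trans (hT.le _)
      · exact (mem_pathSide hθ hz).1.le
    have hsub : ∀ e ∈ (⋃ t ∈ insert (flipTile θ u hj hlt) T, t.edges θ) ∪ leftSides θ ∪
        rightSides θ (flip u hj), e ∈ E ∨
          ∃ k : Fin n, ((k : ℕ) = j ∨ (k : ℕ) = j + 1) ∧ e = pathSide θ (flip u hj) k := by
      rintro e ((he | he) | ⟨k, rfl⟩)
      · simp only [Set.mem_iUnion] at he
        obtain ⟨t, ht, he⟩ := he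
        rcases Finset.mem_insert.1 ht with rfl | ht
        · rw [edges_flipTile] at he
          rcases he with rfl | rfl | rfl | rfl
          · exact Or.inl (Or.inr ⟨_, rfl⟩)
          · exact Or.inr ⟨_, Or.inl rfl, rfl⟩
          · exact Or.inl (Or.inr ⟨_, rfl⟩)
          · exact Or.inr ⟨_, Or.inr rfl, rfl⟩
        · exact Or.inl (Or.inl (Or.inl (Set.mem_biUnion ht he)))
      · exact Or.inl (Or.inl (Or.inr he))
      · by_cases hk : (k : ℕ) = j ∨ (k : ℕ) = j + 1
        · exact Or.inr ⟨k, hk, rfl⟩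
        · push Not at hk
          rw [pathSide_flip_of_ne θ u hj k hk.1 hk.2]
          exact Or.inl (Or.inr ⟨k, rfl⟩)
    have hnew : ∀ e ∈ E, ∀ k : Fin n, ((k : ℕ) = j ∨ (k : ℕ) = j + 1) →
        ¬(e ∩ pathSide θ (flip u hj) k).Nontrivial := by
      rintro e he k hk ⟨z, hz, z', hz', hne⟩
      obtain ⟨p, hp⟩ := exists_eq_of_mem_pathSide_flip hθ u hj hlt k hk
      exact hne ((hp z hz.2 (hleft e he z hz.1)).trans (hp z' hz'.2 (hleft e he z' hz'.1)).symm)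
    intro e he e' he' hnt
    rcases hsub e he with h1 | ⟨k, hk, rfl⟩
    · rcases hsub e' he' with h2 | ⟨k', hk', rfl⟩
      · exact hT.edge_to_edge e h1 e' h2 hnt
      · exact absurd hnt (hnew e h1 k' hk')
    · rcases hsub e' he' with h2 | ⟨k', hk', rfl⟩
      · rw [Set.inter_comm] at hnt
        exact absurd hnt (hnew e' h2 k hk)
      · by_contra hne
        exact Set.not_nontrivial_iff.2
          (pathSide_inter_subsingleton hθ _ (fun hik => hne (by rw [hik]))) hnt
  left_side i := by
    rcases hT.left_side i with ⟨k, hk⟩ | ⟨t, ht, he⟩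
    · by_cases hk' : (k : ℕ) = j ∨ (k : ℕ) = j + 1
      · right
        refine ⟨_, Finset.mem_insert_self _ _, ?_⟩
        rw [← hk]
        exact pathSide_mem_edges θ u hj hlt k hk'
      · push Not at hk'
        left
        exact ⟨k, by rw [pathSide_flip_of_ne θ u hj k hk'.1 hk'.2, hk]⟩
    · exact Or.inr ⟨t, Finset.mem_insert_of_mem ht, he⟩

/-- Exchanges that stay below `w` reduce `inversionGap`. Keeping the given tiles in `T'` is what
later allows prescribed perimeter tiles. -/
lemma IsPartialTiling.exists_extension (hθ : IsSideDirections θ) {u w : Equiv.Perm (Fin n)}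
    {T : Finset (Rhombus n)} (hT : IsPartialTiling θ u T) (h : InvLE u w) :
    ∃ T', T ⊆ T' ∧ IsPartialTiling θ w T' := by
  classical
  induction hm : inversionGap u w using Nat.strong_induction_on generalizing u T with
  | _ m ih =>
    by_cases huw : u = w
    · exact ⟨T, subset_rfl, huw ▸ hT⟩
    · obtain ⟨j, hj, hlt, hinv⟩ := h.exists_flip huw
      obtain ⟨T', h1, h2⟩ := ih _ (hm ▸ inversionGap_flip_lt hlt hinv)
        (hT.insert_flipTile hθ hj hlt) (h.flip_le hinv) rfl
      exact ⟨T', (Finset.subset_insert _ _).trans h1, h2⟩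

lemma pathX_one_le (hθ : IsSideDirections θ) (w : Equiv.Perm (Fin n)) (h : ℝ) :
    pathX θ 1 h ≤ pathX θ w h := by
  obtain ⟨T, -, hT⟩ := (isPartialTiling_one hθ).exists_extension hθ (InvLE.one_le w)
  exact hT.le h

/-- For a contiguous region, the two boundaries have no inner vertex in common. -/
lemma pathVertex_ne (hθ : IsSideDirections θ) {w : Equiv.Perm (Fin n)} (hw : IsContiguous w)
    {i j : ℕ} (hi : 1 ≤ i) (hin : i < n) (hj : j ≤ n) :
    pathVertex θ 1 i ≠ pathVertex θ w j := by
  intro heq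
  set A := Finset.univ.filter fun k : Fin n => (k : ℕ) < i with hA
  set B := (Finset.univ.filter fun k : Fin n => (k : ℕ) < j).image w with hB
  have hsum : ∑ k ∈ A, sideVec θ k = ∑ k ∈ B, sideVec θ k := by
    rw [hB, Finset.sum_image w.injective.injOn]
    exact heq
  have hsplit : ∑ k ∈ A \ B, sideVec θ k = ∑ k ∈ B \ A, sideVec θ k := by
    have h1 := Finset.sum_inter_add_sum_sdiff A B (sideVec θ)
    have h2 := Finset.sum_inter_add_sum_sdiff B A (sideVec θ)
    rw [Finset.inter_comm] at h2
    exact add_left_cancel (h1.trans (hsum.trans h2.symm))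
  -- The determinant with the vector of label `c` is negative on the labels of `A` and nonnegative
  -- on all others. Equality of the sums over `A \ B` and `B \ A` then empties `A \ B`; what remains
  -- of `B` sums to zero although its vectors point downwards.
  set c : Fin n := ⟨i, hin⟩
  have hdet : ∀ S : Finset (Fin n), det (sideVec θ c) (∑ k ∈ S, sideVec θ k) =
      ∑ k ∈ S, det (sideVec θ c) (sideVec θ k) := by
    intro S
    simp only [det, Complex.re_sum, Complex.im_sum, Finset.mul_sum, Finset.sum_sub_distrib]
  have hAB : A ⊆ B := by
    rw [← Finset.sdiff_eq_empty_iff_subset]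
    by_contra hne
    have h1 : ∑ k ∈ A \ B, det (sideVec θ c) (sideVec θ k) < 0 := by
      apply Finset.sum_neg _ (Finset.nonempty_iff_ne_empty.2 hne)
      intro k hk
      have hk := (Finset.mem_filter.1 (Finset.mem_sdiff.1 hk).1).2
      have := det_pos hθ (show k < c from hk)
      simp only [det] at this ⊢
      linarith
    have h2 : 0 ≤ ∑ k ∈ B \ A, det (sideVec θ c) (sideVec θ k) := by
      apply Finset.sum_nonneg
      intro k hk
      have hk : ¬ (k : ℕ) < i := by simpa [hA] using (Finset.mem_sdiff.1 hk).2
      rcases (show c ≤ k from not_lt.1 hk).lt_or_eq with h | h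
      · exact (det_pos hθ h).le
      · rw [← h, det]
        linarith
    rw [← hdet] at h1 h2
    rw [hsplit] at h1
    linarith
  have hBA : B ⊆ A := by
    rw [← Finset.sdiff_eq_empty_iff_subset]
    by_contra hne
    have h1 : ∑ k ∈ B \ A, (sideVec θ k).im < 0 :=
      Finset.sum_neg (fun k _ => sideVec_im_neg hθ k) (Finset.nonempty_iff_ne_empty.2 hne)
    rw [← Complex.im_sum, ← hsplit, Finset.sdiff_eq_empty_iff_subset.2 hAB] at h1
    simp at h1
  have hcard : ∀ m, m ≤ n → (Finset.univ.filter fun k : Fin n => (k : ℕ) < m).card = m := by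
    intro m hm
    have : (Finset.univ.filter fun k : Fin n => (k : ℕ) < m) =
        Finset.univ.map (Fin.castLEEmb hm) := by
      ext k
      simp only [Finset.mem_filter, Finset.mem_univ, true_and, Finset.mem_map]
      exact ⟨fun h => ⟨⟨k, h⟩, rfl⟩, fun ⟨l, hl⟩ => hl ▸ l.2⟩
    rw [this, Finset.card_map, Finset.card_univ, Fintype.card_fin]
  have hEq : A = B := hAB.antisymm hBA
  have hij : i = j := by
    have := congrArg Finset.card hEq
    rwa [hB, Finset.card_image_of_injective _ w.injective, hcard i hin.le, hcard j hj] at this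
  subst hij
  apply hw i hi hin
  have := congrArg (fun S : Finset (Fin n) => (S : Set (Fin n))) hEq
  simp only [hA, hB, Finset.coe_image, Finset.coe_filter, Finset.mem_univ, true_and] at this
  exact this.symm

lemma IsPartialTiling.isRhombicTiling (hθ : IsSideDirections θ) (hn : 1 < n)
    {w : Equiv.Perm (Fin n)} (hw : IsContiguous w) {T : Finset (Rhombus n)}
    (hT : IsPartialTiling θ w T) : IsRhombicTiling θ w T where
  cover := by
    ext z
    rw [mem_region_iff hθ (by omega)]
    simp only [Set.mem_iUnion]
    constructor
    · rintro ⟨t, ht, hz⟩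
      exact ⟨hT.height t ht z hz, hT.subset t ht z hz⟩
    · rintro ⟨h0, h1, h2⟩
      rcases h1.lt_or_eq with h1 | h1
      · obtain ⟨t, ht, hz⟩ := hT.cover z h1 h2
        exact ⟨t, ht, hz⟩
      · obtain ⟨_, ⟨i, rfl⟩, hz⟩ := (mem_pathSides_iff hθ (by omega) 1).2 ⟨h0, h1.symm⟩
        -- No side belongs to both boundaries: its upper endpoint, or its lower one when it is the
        -- first left side, would be an inner vertex common to both.
        rcases hT.left_side i with ⟨k, hk⟩ | ⟨t, ht, he⟩
        · exfalso
          rw [pathSide_eq, pathSide_eq] at hk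
          obtain ⟨h3, h4⟩ := segment_sideVec_inj hθ hk
          by_cases hi : 1 ≤ (i : ℕ)
          · exact pathVertex_ne hθ hw hi i.2 k.2.le h3.symm
          · apply pathVertex_ne (j := k + 1) hθ hw (le_refl 1) hn k.2
            have hi0 : (i : ℕ) = 0 := by omega
            have h5 : pathVertex θ 1 1 = pathVertex θ 1 (i + 1) := by rw [hi0]
            rw [h5, pathVertex_succ θ 1 i.2, pathVertex_succ θ w k.2, h4, h3]
        · exact ⟨t, ht, t.subset_carrier_of_mem_edges he hz⟩
  disjoint := hT.disjoint
  edge_to_edge := hT.edge_to_edge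

lemma IsRhombicTiling.isTilingBetween (hθ : IsSideDirections θ) (hn : 0 < n)
    {w : Equiv.Perm (Fin n)} {T : Finset (Rhombus n)} (hT : IsRhombicTiling θ w T) :
    IsTilingBetween θ 1 w T where
  le := pathX_one_le hθ w
  subset t ht z hz := by
    have : z ∈ region θ w := by
      rw [← hT.cover]
      exact Set.mem_biUnion ht hz
    exact ((mem_region_iff hθ hn w).1 this).2
  cover z h1 h2 := by
    have h0 : z.im ∈ Set.Icc (∑ i, sideVec θ i).im 0 := by
      constructor
      · by_contra hc
        push Not at hc
        rw [pathX_of_le hθ _ hc.le] at h1 h2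
        exact lt_asymm h1 h2
      · by_contra hc
        push Not at hc
        rw [pathX_of_nonneg hθ _ hc.le] at h1 h2
        exact lt_asymm h1 h2
    have : z ∈ region θ w := (mem_region_iff hθ hn w).2 ⟨h0, h1.le, h2.le⟩
    rw [← hT.cover] at this
    simp only [Set.mem_iUnion] at this
    obtain ⟨t, ht, hz⟩ := this
    exact ⟨t, ht, hz⟩
  disjoint := hT.disjoint
  edge_to_edge := hT.edge_to_edge

/-! ### Permutations without distant descents -/

lemma add_sub_le_of_forall_lt {f : ℕ → ℕ} {s e : ℕ} (h : ∀ p, s ≤ p → p < e → f p < f (p + 1))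
    {p q : ℕ} (hp : s ≤ p) (hpq : p ≤ q) (hq : q ≤ e) : f p + (q - p) ≤ f q := by
  induction q, hpq using Nat.le_induction with
  | base => simp
  | succ q hpq ih =>
    have h1 := ih (by omega)
    have h2 := h q (by omega) (by omega)
    omega

/-- Any two descents of `f` are at distance at most one. -/
def NoDistantDescents (n : ℕ) (f : ℕ → ℕ) : Prop :=
  ∀ p q, p + 1 < n → q + 1 < n → f (p + 1) < f p → f (q + 1) < f q → q ≤ p + 1

/-- Here `f` is the permutation and `g` its inverse, counted from 0. With `k = f 0`, `q = g 0`, `m =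
f (n - 1)`, `r = g (n - 1)`, there are descents of `g` at `k - 1` and `m`, and of `f` at `q - 1` and
`r`. Everything follows from how close these have to be. -/
lemma exists_form_of_noDistantDescents {n : ℕ} {f g : ℕ → ℕ} (hn : 1 < n)
    (hf : ∀ p, p < n → f p < n) (hg : ∀ p, p < n → g p < n) (hgf : ∀ p, p < n → g (f p) = p)
    (hfg : ∀ p, p < n → f (g p) = p) (hdf : NoDistantDescents n f)
    (hdg : NoDistantDescents n g) (h0 : f 0 ≠ 0) (hl : f (n - 1) ≠ n - 1) :
    ∃ k, 1 ≤ k ∧ k ≤ n - 1 ∧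
      ((∀ p, p < n → f p = if p < n - k then p + k else p - (n - k)) ∨
        ∀ p, p < n → f p = if p < n - k then p + k else if p = n - k then k - 1
          else p - (n - k) - 1) := by
  have hfinj : ∀ p q, p < n → q < n → f p = f q → p = q := fun p q hp hq h => by
    rw [← hgf p hp, h, hgf q hq]
  have hginj : ∀ p q, p < n → q < n → g p = g q → p = q := fun p q hp hq h => by
    rw [← hfg p hp, h, hfg q hq]
  have hk := hf 0 (by omega)
  have hq := hg 0 (by omega)
  have hm := hf (n - 1) (by omega)
  have hr := hg (n - 1) (by omega)
  have ek := hgf 0 (by omega)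
  have eq := hfg 0 (by omega)
  have em := hgf (n - 1) (by omega)
  have er := hfg (n - 1) (by omega)
  generalize hkd : f 0 = k at *
  generalize hqd : g 0 = q at *
  generalize hmd : f (n - 1) = m at *
  generalize hrd : g (n - 1) = r at *
  have hq0 : q ≠ 0 := by
    rintro rfl
    omega
  have hrn : r ≠ n - 1 := by
    rintro rfl
    omega
  have dk : g (k - 1 + 1) < g (k - 1) := by
    rw [Nat.sub_add_cancel (by omega), ek]
    have := hginj (k - 1) k (by omega) hk
    omega
  have dq : f (q - 1 + 1) < f (q - 1) := by
    rw [Nat.sub_add_cancel (by omega), eq]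
    have := hfinj (q - 1) q (by omega) hq
    omega
  have dm : g (m + 1) < g m := by
    have := hginj (m + 1) m (by omega) hm
    have := hg (m + 1) (by omega)
    omega
  have dr : f (r + 1) < f r := by
    have := hfinj (r + 1) r (by omega) hr
    have := hf (r + 1) (by omega)
    omega
  have mg : ∀ p, p + 1 < n → ¬ g (p + 1) < g p → g p < g (p + 1) := fun p hp h => by
    have := hginj p (p + 1) (by omega) hp
    omega
  have mf : ∀ p, p + 1 < n → ¬ f (p + 1) < f p → f p < f (p + 1) := fun p hp h => by
    have := hfinj p (p + 1) (by omega) hp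
    omega
  -- A descent of `g` beyond `k - 1` could only be at `k`, where `g` has its minimum 0. The next
  -- three stretches are monotone for similar reasons.
  have a1 : ∀ p, k ≤ p → p < n - 1 → g p < g (p + 1) := fun p h1 h2 => by
    refine mg p (by omega) fun hd => ?_
    have := hdg (k - 1) p (by omega) (by omega) dk hd
    obtain rfl : p = k := by omega
    omega
  have a2 : ∀ p, 0 ≤ p → p < m → g p < g (p + 1) := fun p _ h2 => by
    refine mg p (by omega) fun hd => ?_
    have := hdg p m (by omega) (by omega) hd dm
    obtain rfl : m = p + 1 := by omega
    have := hg p (by omega)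
    omega
  have b1 : ∀ p, 0 ≤ p → p < r → f p < f (p + 1) := fun p _ h2 => by
    refine mf p (by omega) fun hd => ?_
    have := hdf p r (by omega) (by omega) hd dr
    obtain rfl : r = p + 1 := by omega
    have := hf p (by omega)
    omega
  have b2 : ∀ p, q ≤ p → p < n - 1 → f p < f (p + 1) := fun p h1 h2 => by
    refine mf p (by omega) fun hd => ?_
    have := hdf (q - 1) p (by omega) (by omega) dq hd
    obtain rfl : p = q := by omega
    omega
  have c2 := hdf (q - 1) r (by omega) (by omega) dq dr
  have c3 := hdf r (q - 1) (by omega) (by omega) dr dq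
  have hrq : r ≠ q := by
    rintro rfl
    omega
  have i1 := add_sub_le_of_forall_lt b1 (Nat.zero_le 0) (Nat.zero_le r) le_rfl
  have i2 := add_sub_le_of_forall_lt a1 le_rfl (by omega : k ≤ n - 1) le_rfl
  have i3 := add_sub_le_of_forall_lt b2 le_rfl (by omega : q ≤ n - 1) le_rfl
  have i4 := add_sub_le_of_forall_lt a2 (Nat.zero_le 0) (Nat.zero_le m) le_rfl
  -- Growth of `f` up to `r` gives `k + r ≤ n - 1`, growth of `g` from `k` gives the reverse. So `f`
  -- has no room to skip a value on this stretch; `hlower` uses `q + m = n - 1` in the same way.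
  have hupper : ∀ p, p ≤ r → f p = p + k := fun p hp => by
    have h1 := add_sub_le_of_forall_lt b1 (Nat.zero_le 0) (Nat.zero_le p) hp
    have h2 := add_sub_le_of_forall_lt b1 (Nat.zero_le p) hp le_rfl
    omega
  have hlower : ∀ p, q ≤ p → p < n → f p = p - q := fun p hp hpn => by
    have h1 := add_sub_le_of_forall_lt b2 le_rfl hp (by omega)
    have h2 := add_sub_le_of_forall_lt b2 hp (by omega : p ≤ n - 1) le_rfl
    omega
  refine ⟨k, by omega, by omega, ?_⟩
  rcases (by omega : q = r + 1 ∨ q = r + 2) with hqr | hqr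
  · left
    intro p hp
    split_ifs with h
    · exact hupper p (by omega)
    · rw [hlower p (by omega) hp]
      omega
  · right
    intro p hp
    split_ifs with h h'
    · exact hupper p (by omega)
    -- One position remains between the two runs. Values from `k` on are used by the upper run and
    -- values below `k - 1` by the lower one.
    · have hv := hf p hp
      have h1 : ¬ k ≤ f p := fun hc => by
        have e := hupper (f p - k) (by omega)
        have := hfinj (f p - k) p (by omega) hp (by omega)
        omega
      have h2 : ¬ f p + 1 < k := fun hc => by
        have e := hlower (q + f p) (by omega) (by omega)
        have := hfinj (q + f p) p (by omega) hp (by omega)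
        omega
      omega
    · rw [hlower p (by omega) hp]
      omega

/-- The descents of `f` can only be at `n - k - 1` and, in the second form, `n - k`; those of `g`
only at `k - 1` and, in the second form, `k - 2`. -/
lemma noDistantDescents_of_form {n k : ℕ} {f g : ℕ → ℕ} (hk : 1 ≤ k) (hkn : k ≤ n - 1)
    (hgf : ∀ p, p < n → g (f p) = p)
    (h : (∀ p, p < n → f p = if p < n - k then p + k else p - (n - k)) ∨
        ∀ p, p < n → f p = if p < n - k then p + k else if p = n - k then k - 1
          else p - (n - k) - 1) :
    NoDistantDescents n f ∧ NoDistantDescents n g := by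
  rcases h with h | h
  · have hg : ∀ v, v < n → g v = if v < k then v + (n - k) else v - k := by
      intro v hv
      split_ifs with hvk
      · have e := h (v + (n - k)) (by omega)
        rw [if_neg (by omega), Nat.add_sub_cancel] at e
        have := hgf (v + (n - k)) (by omega)
        rwa [e] at this
      · have e := h (v - k) (by omega)
        rw [if_pos (by omega), Nat.sub_add_cancel (by omega)] at e
        have := hgf (v - k) (by omega)
        rwa [e] at this
    constructor
    · intro p q hp hq h1 h2
      rw [h _ (by omega), h _ (by omega)] at h1 h2
      split_ifs at h1 h2 <;> omega
    · intro p q hp hq h1 h2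
      rw [hg _ (by omega), hg _ (by omega)] at h1 h2
      split_ifs at h1 h2 <;> omega
  · have hg : ∀ v, v < n → g v = if v < k - 1 then v + (n - k) + 1 else if v = k - 1 then n - k
        else v - k := by
      intro v hv
      split_ifs with hvk hvk'
      · have e := h (v + (n - k) + 1) (by omega)
        rw [if_neg (by omega), if_neg (by omega),
          (by omega : v + (n - k) + 1 - (n - k) - 1 = v)] at e
        have := hgf (v + (n - k) + 1) (by omega)
        rwa [e] at this
      · have e := h (n - k) (by omega)
        rw [if_neg (by omega), if_pos rfl, ← hvk'] at e
        have := hgf (n - k) (by omega)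
        rwa [e] at this
      · have e := h (v - k) (by omega)
        rw [if_pos (by omega), Nat.sub_add_cancel (by omega)] at e
        have := hgf (v - k) (by omega)
        rwa [e] at this
    constructor
    · intro p q hp hq h1 h2
      rw [h _ (by omega), h _ (by omega)] at h1 h2
      split_ifs at h1 h2 <;> omega
    · intro p q hp hq h1 h2
      rw [hg _ (by omega), hg _ (by omega)] at h1 h2
      split_ifs at h1 h2 <;> omega

/-- A permutation of `Fin n` as a function on the natural numbers. -/
def toNatFun (w : Equiv.Perm (Fin n)) (p : ℕ) : ℕ :=
  if h : p < n then w ⟨p, h⟩ else 0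

lemma toNatFun_of_lt (w : Equiv.Perm (Fin n)) {p : ℕ} (h : p < n) :
    toNatFun w p = w ⟨p, h⟩ := dif_pos h

lemma toNatFun_lt (w : Equiv.Perm (Fin n)) {p : ℕ} (h : p < n) : toNatFun w p < n := by
  rw [toNatFun_of_lt w h]
  exact (w _).2

lemma toNatFun_symm_apply (w : Equiv.Perm (Fin n)) {p : ℕ} (h : p < n) :
    toNatFun w.symm (toNatFun w p) = p := by
  rw [toNatFun_of_lt w h, toNatFun_of_lt w.symm (w _).2]
  simp

lemma toNatFun_apply_symm (w : Equiv.Perm (Fin n)) {p : ℕ} (h : p < n) :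
    toNatFun w (toNatFun w.symm p) = p :=
  toNatFun_symm_apply w.symm h

lemma oneLine_eq_iff₁ (w : Equiv.Perm (Fin n)) {k : ℕ} (hk : 1 ≤ k) (hkn : k ≤ n - 1) :
    oneLine w = List.range' (k + 1) (n - k) ++ List.range' 1 k ↔
      ∀ p, p < n → toNatFun w p = if p < n - k then p + k else p - (n - k) := by
  rw [oneLine, List.ext_getElem_iff]
  simp only [List.length_ofFn, List.length_append, List.length_range', List.getElem_ofFn,
    List.getElem_append, List.getElem_range']
  constructor
  · rintro ⟨-, h⟩ p hp
    have := h p hp (by omega)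
    rw [toNatFun_of_lt w hp]
    split_ifs at this ⊢ <;> omega
  · intro h
    refine ⟨by omega, fun p hp _ => ?_⟩
    have := h p hp
    rw [toNatFun_of_lt w hp] at this
    split_ifs at this ⊢ <;> omega

lemma oneLine_eq_iff₂ (w : Equiv.Perm (Fin n)) {k : ℕ} (hk : 1 ≤ k) (hkn : k ≤ n - 1) :
    oneLine w = List.range' (k + 1) (n - k) ++ [k] ++ List.range' 1 (k - 1) ↔
      ∀ p, p < n → toNatFun w p = if p < n - k then p + k else if p = n - k then k - 1
          else p - (n - k) - 1 := by
  rw [oneLine, List.ext_getElem_iff]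
  simp only [List.length_ofFn, List.length_append, List.length_range', List.getElem_ofFn,
    List.getElem_append, List.getElem_range', List.length_singleton, List.getElem_singleton]
  constructor
  · rintro ⟨-, h⟩ p hp
    have := h p hp (by omega)
    rw [toNatFun_of_lt w hp]
    split_ifs at this ⊢ <;> omega
  · intro h
    refine ⟨by omega, fun p hp _ => ?_⟩
    have := h p hp
    rw [toNatFun_of_lt w hp] at this
    split_ifs at this ⊢ <;> omega

lemma IsContiguous.toNatFun_zero_ne {w : Equiv.Perm (Fin n)} (hw : IsContiguous w) (hn : 1 < n) :
    toNatFun w 0 ≠ 0 := by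
  intro h
  rw [toNatFun_of_lt w (by omega)] at h
  apply hw 1 le_rfl hn
  have h' : w ⟨0, by omega⟩ = ⟨0, by omega⟩ := Fin.ext h
  have : {i : Fin n | (i : ℕ) < 1} = {⟨0, by omega⟩} := by
    ext i
    simp [Fin.ext_iff]
  rw [this, Set.image_singleton, h']

lemma IsContiguous.toNatFun_last_ne {w : Equiv.Perm (Fin n)} (hw : IsContiguous w) (hn : 1 < n) :
    toNatFun w (n - 1) ≠ n - 1 := by
  intro h
  rw [toNatFun_of_lt w (by omega)] at h
  apply hw (n - 1) (by omega) (by omega)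
  have h' : w ⟨n - 1, by omega⟩ = ⟨n - 1, by omega⟩ := Fin.ext h
  have : {i : Fin n | (i : ℕ) < n - 1} = {⟨n - 1, by omega⟩}ᶜ := by
    ext i
    simp only [Set.mem_ofPred_eq, Set.mem_compl_iff, Set.mem_singleton_iff, Fin.ext_iff]
    omega
  rw [this, Set.image_compl_eq w.bijective, Set.image_singleton, h']

/-- The permutations with no two distant descents, such that the same holds for their inverses. -/
lemma noDistantDescents_iff {w : Equiv.Perm (Fin n)} (hw : IsContiguous w) (hn : 1 < n) :
    (NoDistantDescents n (toNatFun w) ∧ NoDistantDescents n (toNatFun w.symm)) ↔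
      ∃ k : ℕ, 1 ≤ k ∧ k ≤ n - 1 ∧
        (oneLine w = List.range' (k + 1) (n - k) ++ List.range' 1 k ∨
          oneLine w = List.range' (k + 1) (n - k) ++ [k] ++ List.range' 1 (k - 1)) := by
  constructor
  · rintro ⟨h1, h2⟩
    obtain ⟨k, hk, hkn, h⟩ := exists_form_of_noDistantDescents hn (fun p => toNatFun_lt w)
      (fun p => toNatFun_lt w.symm) (fun p => toNatFun_symm_apply w)
      (fun p => toNatFun_apply_symm w) h1 h2 (hw.toNatFun_zero_ne hn) (hw.toNatFun_last_ne hn)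
    refine ⟨k, hk, hkn, ?_⟩
    rwa [oneLine_eq_iff₁ w hk hkn, oneLine_eq_iff₂ w hk hkn]
  · rintro ⟨k, hk, hkn, h⟩
    rw [oneLine_eq_iff₁ w hk hkn, oneLine_eq_iff₂ w hk hkn] at h
    exact noDistantDescents_of_form hk hkn (fun p => toNatFun_symm_apply w) h

lemma noDistantDescents_toNatFun_iff (w : Equiv.Perm (Fin n)) :
    NoDistantDescents n (toNatFun w) ↔ ∀ i j, ∀ (hi : i + 1 < n) (hj : j + 1 < n),
      w ⟨i + 1, hi⟩ < w ⟨i, by omega⟩ → w ⟨j + 1, hj⟩ < w ⟨j, by omega⟩ → j ≤ i + 1 := by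
  constructor
  · intro h i j hi hj h1 h2
    apply h i j hi hj
    · rwa [toNatFun_of_lt w hi, toNatFun_of_lt w (by omega)]
    · rwa [toNatFun_of_lt w hj, toNatFun_of_lt w (by omega)]
  · intro h i j hi hj h1 h2
    rw [toNatFun_of_lt w hi, toNatFun_of_lt w (by omega)] at h1
    rw [toNatFun_of_lt w hj, toNatFun_of_lt w (by omega)] at h2
    exact h i j hi hj h1 h2

/-! ### Side-perimeter tiles -/

lemma pathVertex_injective (hθ : IsSideDirections θ) (u : Equiv.Perm (Fin n)) {i j : ℕ}
    (hi : i ≤ n) (hj : j ≤ n) (h : pathVertex θ u i = pathVertex θ u j) : i = j := by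
  by_contra hne
  wlog hij : i < j generalizing i j
  · exact this hj hi h.symm (Ne.symm hne) (by omega)
  have h1 : (pathVertex θ u j).im ≤ (pathVertex θ u (i + 1)).im :=
    pathVertex_im_antitone hθ u hij
  rw [pathVertex_succ θ u (by omega : i < n), h, Complex.add_im] at h1
  linarith [sideVec_im_neg hθ (u ⟨i, by omega⟩)]

lemma pathSide_injective (hθ : IsSideDirections θ) (u : Equiv.Perm (Fin n)) :
    Function.Injective (pathSide θ u) := by
  intro i k h
  rw [pathSide_eq, pathSide_eq] at h
  exact u.injective (segment_sideVec_inj hθ h).2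

/-- A tile with two edges on a path is located at two consecutive sides of that path. -/
lemma exists_of_nontrivial (hθ : IsSideDirections θ) {u : Equiv.Perm (Fin n)} {t : Rhombus n}
    (h : (t.edges θ ∩ Set.range (pathSide θ u)).Nontrivial) :
    ∃ j, ∃ hj : j + 1 < n, t.top = pathVertex θ u j ∧
      ((t.a = u ⟨j, by omega⟩ ∧ t.b = u ⟨j + 1, hj⟩) ∨
        (t.a = u ⟨j + 1, hj⟩ ∧ t.b = u ⟨j, by omega⟩)) := by
  have key : ∀ k : Fin n, pathSide θ u k ∈ t.edges θ →
      (u k = t.a ∧ (pathVertex θ u k = t.top ∨ pathVertex θ u k = t.top + sideVec θ t.b)) ∨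
      (u k = t.b ∧ (pathVertex θ u k = t.top ∨ pathVertex θ u k = t.top + sideVec θ t.a)) := by
    intro k hk
    rw [pathSide_eq] at hk
    rcases hk with hk | hk | hk | hk
    · have := segment_sideVec_inj hθ hk
      exact Or.inl ⟨this.2, Or.inl this.1⟩
    · have := segment_sideVec_inj hθ hk
      exact Or.inr ⟨this.2, Or.inl this.1⟩
    · have := segment_sideVec_inj hθ hk
      exact Or.inr ⟨this.2, Or.inr this.1⟩
    · rw [add_right_comm] at hk
      have := segment_sideVec_inj hθ hk
      exact Or.inl ⟨this.2, Or.inr this.1⟩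
  obtain ⟨k, k', hka, hkb, h1, h2⟩ : ∃ k k' : Fin n, u k = t.a ∧ u k' = t.b ∧
      (pathVertex θ u k = t.top ∨ pathVertex θ u k = t.top + sideVec θ t.b) ∧
      (pathVertex θ u k' = t.top ∨ pathVertex θ u k' = t.top + sideVec θ t.a) := by
    obtain ⟨_, ⟨he, k, rfl⟩, _, ⟨he', k', rfl⟩, hne⟩ := h
    have hne' : u k ≠ u k' := u.injective.ne fun hkk => hne (by rw [hkk])
    rcases key k he with ⟨h1, h2⟩ | ⟨h1, h2⟩ <;> rcases key k' he' with ⟨h3, h4⟩ | ⟨h3, h4⟩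
    · exact absurd (h1.trans h3.symm) hne'
    · exact ⟨k, k', h1, h3, h2, h4⟩
    · exact ⟨k', k, h3, h1, h4, h2⟩
    · exact absurd (h1.trans h3.symm) hne'
  have hne : (k : ℕ) ≠ k' := fun hkk => t.a_lt_b.ne (by rw [← hka, ← hkb, Fin.ext hkk])
  have s1 := pathVertex_succ θ u k.2
  have s2 := pathVertex_succ θ u k'.2
  simp only [Fin.eta, hka] at s1
  simp only [Fin.eta, hkb] at s2
  -- Two edges that both start at the top, or both end at the bottom, would occupy one position of
  -- the path. In the mixed cases the positions are consecutive.
  rcases h1 with h1 | h1 <;> rcases h2 with h2 | h2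
  · exact absurd (pathVertex_injective hθ u k.2.le k'.2.le (h1.trans h2.symm)) hne
  · have e : (k : ℕ) + 1 = k' :=
      pathVertex_injective hθ u k.2 k'.2.le (by rw [s1, h1, h2])
    refine ⟨k, by omega, h1.symm, Or.inl ⟨hka.symm, ?_⟩⟩
    rw [← hkb]
    exact congrArg u (Fin.ext e.symm)
  · have e : (k' : ℕ) + 1 = k :=
      pathVertex_injective hθ u k'.2 k.2.le (by rw [s2, h2, h1])
    refine ⟨k', by omega, h2.symm, Or.inr ⟨?_, hkb.symm⟩⟩
    rw [← hka]
    exact congrArg u (Fin.ext e.symm)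
  · have e : (k : ℕ) + 1 = k' + 1 :=
      pathVertex_injective hθ u k.2 k'.2 (by rw [s1, s2, h1, h2, add_right_comm])
    omega

lemma nontrivial_of_pathSide_mem_edges (hθ : IsSideDirections θ) {u : Equiv.Perm (Fin n)}
    {t : Rhombus n} {j : ℕ} (hj : j + 1 < n)
    (h : ∀ k : Fin n, (k : ℕ) = j ∨ (k : ℕ) = j + 1 → pathSide θ u k ∈ t.edges θ) :
    (t.edges θ ∩ Set.range (pathSide θ u)).Nontrivial := by
  refine ⟨_, ⟨h ⟨j, by omega⟩ (Or.inl rfl), _, rfl⟩, _, ⟨h ⟨j + 1, hj⟩ (Or.inr rfl), _, rfl⟩, ?_⟩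
  apply (pathSide_injective hθ u).ne
  simp [Fin.ext_iff]

lemma isLeftPerimeter_iff (hθ : IsSideDirections θ) {t : Rhombus n} :
    IsLeftPerimeter θ t ↔ ∃ i, ∃ hi : i + 1 < n,
      t = flipTile θ 1 hi (by simp [Fin.lt_def]) := by
  constructor
  · intro h
    obtain ⟨i, hi, h1, ⟨h2, h3⟩ | ⟨h2, h3⟩⟩ := exists_of_nontrivial hθ h
    · exact ⟨i, hi, Rhombus.ext h1 h2 h3⟩
    · have := t.a_lt_b
      rw [h2, h3] at this
      simp [Fin.lt_def] at this
  · rintro ⟨i, hi, rfl⟩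
    exact nontrivial_of_pathSide_mem_edges hθ hi (pathSide_mem_edges θ 1 hi _)

lemma isRightPerimeter_of_eq (hθ : IsSideDirections θ) {w : Equiv.Perm (Fin n)} {t : Rhombus n}
    {j : ℕ} (hj : j + 1 < n) (h1 : t.top = pathVertex θ w j) (h2 : t.a = w ⟨j + 1, hj⟩)
    (h3 : t.b = w ⟨j, by omega⟩) : IsRightPerimeter θ w t := by
  have hlt : flip w hj ⟨j, by omega⟩ < flip w hj ⟨j + 1, hj⟩ := by
    rw [flip_apply_fst, flip_apply_snd, ← h2, ← h3]
    exact t.a_lt_b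
  have ht : t = flipTile θ (flip w hj) hj hlt := by
    apply Rhombus.ext
    · rw [h1, flipTile_top, pathVertex_flip_of_le θ w hj le_rfl]
    · rw [h2, flipTile_a, flip_apply_fst]
    · rw [h3, flipTile_b, flip_apply_snd]
  refine nontrivial_of_pathSide_mem_edges hθ hj fun k hk => ?_
  have := pathSide_flip_mem_edges θ (flip w hj) hj hlt k hk
  rwa [flip_flip, ← ht] at this

/-- A tile glued to the wrong side of `w` would have its left vertex on `w`. -/
lemma exists_of_isRightPerimeter (hθ : IsSideDirections θ) {u w : Equiv.Perm (Fin n)}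
    {T : Finset (Rhombus n)} (hT : IsTilingBetween θ u w T) {t : Rhombus n} (ht : t ∈ T)
    (h : IsRightPerimeter θ w t) :
    ∃ j, ∃ hj : j + 1 < n, t.top = pathVertex θ w j ∧ t.a = w ⟨j + 1, hj⟩ ∧
      t.b = w ⟨j, by omega⟩ := by
  obtain ⟨j, hj, h1, ⟨h2, h3⟩ | ⟨h2, h3⟩⟩ := exists_of_nontrivial hθ h
  · exfalso
    have hlv := hT.re_lt_of_left_vertex hθ ht
    rw [h1, h2, ← pathVertex_succ θ w (by omega : j < n), pathX_vertex hθ w hj.le] at hlv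
    exact lt_irrefl _ hlv
  · exact ⟨j, hj, h1, h2, h3⟩

lemma bottom_eq_pathVertex {u : Equiv.Perm (Fin n)} {t : Rhombus n} {j : ℕ} (hj : j + 1 < n)
    (h1 : t.top = pathVertex θ u j) (h : (t.a = u ⟨j, by omega⟩ ∧ t.b = u ⟨j + 1, hj⟩) ∨
      (t.a = u ⟨j + 1, hj⟩ ∧ t.b = u ⟨j, by omega⟩)) :
    t.top + sideVec θ t.a + sideVec θ t.b = pathVertex θ u (j + 2) := by
  rw [pathVertex_succ θ u hj, pathVertex_succ θ u (by omega : j < n)]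
  rcases h with ⟨h2, h3⟩ | ⟨h2, h3⟩
  · rw [h1, h2, h3]
  · rw [h1, h2, h3, add_right_comm]

/-- Such a tile would have both its top and its bottom vertex on both boundaries. As `n > 2`, at
least one of them is an inner vertex of the left boundary. -/
lemma not_isRightPerimeter_of_isLeftPerimeter (hθ : IsSideDirections θ) (hn : 2 < n)
    {w : Equiv.Perm (Fin n)} (hw : IsContiguous w) {t : Rhombus n} (h : IsLeftPerimeter θ t) :
    ¬IsRightPerimeter θ w t := by
  intro h'
  obtain ⟨i, hi, h1, h2⟩ := exists_of_nontrivial hθ h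
  obtain ⟨j, hj, h3, h4⟩ := exists_of_nontrivial hθ h'
  have e1 := bottom_eq_pathVertex hi h1 h2
  have e2 := bottom_eq_pathVertex hj h3 h4
  by_cases hi0 : 1 ≤ i
  · exact pathVertex_ne hθ hw hi0 (by omega) (by omega) (h1.symm.trans h3)
  · exact pathVertex_ne hθ hw (by omega) (by omega : i + 2 < n) hj (e1.symm.trans e2)

lemma IsContiguous.one_ne {w : Equiv.Perm (Fin n)} (hw : IsContiguous w) (hn : 1 < n) :
    1 ≠ w := by
  rintro rfl
  exact hw 1 le_rfl hn (by simp)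

lemma Rhombus.coord_eq (hθ : IsSideDirections θ) (t : Rhombus n) {z : ℂ} {x y : ℝ}
    (h : z = t.top + x • sideVec θ t.a + y • sideVec θ t.b) :
    t.coordA θ z = x ∧ t.coordB θ z = y := by
  rw [h, t.coordA_apply hθ, t.coordB_apply hθ]
  exact ⟨rfl, rfl⟩

/-- Both tiles have side `j + 1` of the path as a left edge and contain the points just to the right
of its midpoint. -/
lemma flipTile_eq_of_succ (hθ : IsSideDirections θ) {u : Equiv.Perm (Fin n)}
    {T : Finset (Rhombus n)} (hT : ∀ t ∈ T, ∀ t' ∈ T, t ≠ t' →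
      Disjoint (interior (t.carrier θ)) (interior (t'.carrier θ)))
    {j : ℕ} {hj : j + 1 < n} {hj' : j + 1 + 1 < n} {hlt : u ⟨j, by omega⟩ < u ⟨j + 1, hj⟩}
    {hlt' : u ⟨j + 1, hj⟩ < u ⟨j + 1 + 1, hj'⟩} (h : flipTile θ u hj hlt ∈ T)
    (h' : flipTile θ u hj' hlt' ∈ T) : flipTile θ u hj hlt = flipTile θ u hj' hlt' := by
  obtain ⟨c1, c2⟩ := (flipTile θ u hj hlt).coord_eq hθ (x := 1) (y := 1 / 2)
    (z := pathVertex θ u (j + 1) + (1 / 2 : ℝ) • sideVec θ (u ⟨j + 1, hj⟩))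
    (by rw [pathVertex_succ θ u (by omega : j < n), one_smul]; rfl)
  obtain ⟨c3, c4⟩ := (flipTile θ u hj' hlt').coord_eq hθ (x := 1 / 2) (y := 0)
    (z := pathVertex θ u (j + 1) + (1 / 2 : ℝ) • sideVec θ (u ⟨j + 1, hj⟩))
    (by rw [zero_smul, add_zero]; rfl)
  apply eq_of_left_boundary hθ hT h h'
  · rw [c1, c2]
    norm_num
  · rw [c3, c4]
    norm_num

lemma right_tile_eq_of_succ (hθ : IsSideDirections θ) {w : Equiv.Perm (Fin n)}
    {T : Finset (Rhombus n)} (hT : ∀ t ∈ T, ∀ t' ∈ T, t ≠ t' →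
      Disjoint (interior (t.carrier θ)) (interior (t'.carrier θ)))
    {j : ℕ} (hj : j + 1 < n) (hj' : j + 1 + 1 < n) {t t' : Rhombus n} (ht : t ∈ T) (ht' : t' ∈ T)
    (h1 : t.top = pathVertex θ w j) (h2 : t.a = w ⟨j + 1, hj⟩) (h3 : t.b = w ⟨j, by omega⟩)
    (h1' : t'.top = pathVertex θ w (j + 1)) (h3' : t'.b = w ⟨j + 1, hj⟩) : t = t' := by
  obtain ⟨c1, c2⟩ := t.coord_eq hθ (x := 1 / 2) (y := 1)
    (z := pathVertex θ w (j + 1) + (1 / 2 : ℝ) • sideVec θ (w ⟨j + 1, hj⟩))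
    (by rw [pathVertex_succ θ w (by omega : j < n), one_smul, h1, h2, h3, add_right_comm])
  obtain ⟨c3, c4⟩ := t'.coord_eq hθ (x := 0) (y := 1 / 2)
    (z := pathVertex θ w (j + 1) + (1 / 2 : ℝ) • sideVec θ (w ⟨j + 1, hj⟩))
    (by rw [zero_smul, add_zero, h1', h3'])
  apply eq_of_right_boundary hθ hT ht ht'
  · rw [c1, c2]
    norm_num
  · rw [c3, c4]
    norm_num

/-- If the left and the right descents of `w` are not distant, then every tiling has one
left-perimeter tile and one right-perimeter tile. -/
lemma ncard_sidePerimeterTiles_eq_two (hθ : IsSideDirections θ) (hn : 2 < n)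
    {w : Equiv.Perm (Fin n)} (hw : IsContiguous w)
    (hR : NoDistantDescents n (toNatFun w)) (hL : NoDistantDescents n (toNatFun w.symm))
    {T : Finset (Rhombus n)} (hT : IsRhombicTiling θ w T) :
    (sidePerimeterTiles θ w T).ncard = 2 := by
  classical
  rw [noDistantDescents_toNatFun_iff] at hR hL
  have hB := hT.isTilingBetween hθ (by omega)
  have h1w := hw.one_ne (by omega)
  -- Without this tile, the others form a tiling from `flip 1 hi` to `w`, so the inversion of `flip
  -- 1 hi` is one of `w`.
  have hinv : ∀ i, ∀ (hi : i + 1 < n) (hlt), flipTile θ 1 hi hlt ∈ T →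
      w.symm ⟨i + 1, hi⟩ < w.symm ⟨i, by omega⟩ := by
    intro i hi hlt ht
    exact (hB.erase hθ hi hlt ht).invLE hθ _ _ hlt (symm_flip_lt 1 hi)
  obtain ⟨i, hi, hlt, hleft⟩ := hB.exists_flipTile_mem hθ h1w
  obtain ⟨t, ht, j, hj, h1, h2, h3⟩ := hB.exists_right_tile hθ h1w
  have hl : IsLeftPerimeter θ (flipTile θ 1 hi hlt) := (isLeftPerimeter_iff hθ).2 ⟨i, hi, rfl⟩
  have hr : IsRightPerimeter θ w t := isRightPerimeter_of_eq hθ hj h1 h2 h3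
  rw [Set.ncard_eq_two]
  refine ⟨flipTile θ 1 hi hlt, t, ?_, ?_⟩
  · intro heq
    exact not_isRightPerimeter_of_isLeftPerimeter hθ hn hw hl (heq ▸ hr)
  · ext t'
    simp only [sidePerimeterTiles, Set.mem_ofPred_eq, Set.mem_insert_iff, Set.mem_singleton_iff]
    constructor
    · rintro ⟨ht', h' | h'⟩
      · left
        obtain ⟨i', hi', rfl⟩ := (isLeftPerimeter_iff hθ).1 h'
        have d1 := hinv i hi _ hleft
        have d2 := hinv i' hi' _ ht'
        have := hL i i' hi hi' d1 d2
        have := hL i' i hi' hi d2 d1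
        rcases (by omega : i' = i ∨ i' = i + 1 ∨ i = i' + 1) with rfl | rfl | rfl
        · rfl
        · exact (flipTile_eq_of_succ hθ hT.disjoint hleft ht').symm
        · exact flipTile_eq_of_succ hθ hT.disjoint ht' hleft
      · right
        obtain ⟨j', hj', h1', h2', h3'⟩ := exists_of_isRightPerimeter hθ hB ht' h'
        have d1 : w ⟨j + 1, hj⟩ < w ⟨j, by omega⟩ := h2 ▸ h3 ▸ t.a_lt_b
        have d2 : w ⟨j' + 1, hj'⟩ < w ⟨j', by omega⟩ := h2' ▸ h3' ▸ t'.a_lt_b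
        have := hR j j' hj hj' d1 d2
        have := hR j' j hj' hj d2 d1
        rcases (by omega : j' = j ∨ j' = j + 1 ∨ j = j' + 1) with rfl | rfl | rfl
        · exact Rhombus.ext (h1'.trans h1.symm) (h2'.trans h2.symm) (h3'.trans h3.symm)
        · exact (right_tile_eq_of_succ hθ hT.disjoint hj hj' ht ht' h1 h2 h3 h1' h3').symm
        · exact right_tile_eq_of_succ hθ hT.disjoint hj' hj ht' ht h1' h2' h3' h1 h3
    · rintro (rfl | rfl)
      · exact ⟨hleft, Or.inl hl⟩
      · exact ⟨ht, Or.inr hr⟩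

lemma ncard_sidePerimeterTiles_ne_two {w : Equiv.Perm (Fin n)} {T : Finset (Rhombus n)}
    {t₁ t₂ t₃ : Rhombus n} (h₁ : t₁ ∈ sidePerimeterTiles θ w T)
    (h₂ : t₂ ∈ sidePerimeterTiles θ w T) (h₃ : t₃ ∈ sidePerimeterTiles θ w T) (h₁₂ : t₁ ≠ t₂)
    (h₁₃ : t₁ ≠ t₃) (h₂₃ : t₂ ≠ t₃) : (sidePerimeterTiles θ w T).ncard ≠ 2 := by
  intro h
  have hfin : (sidePerimeterTiles θ w T).Finite := T.finite_toSet.subset fun t ht => ht.1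
  have h3 := (Set.two_lt_ncard_iff hfin).2 ⟨t₁, t₂, t₃, h₁, h₂, h₃, h₁₂, h₁₃, h₂₃⟩
  omega

/-- If `w` has two distant left descents, then some tiling has two left-perimeter tiles. -/
lemma exists_tiling_of_left_descents (hθ : IsSideDirections θ) (hn : 2 < n)
    {w : Equiv.Perm (Fin n)} (hw : IsContiguous w) {i i' : ℕ} (hi : i + 1 < n) (hi' : i' + 1 < n)
    (hii : i + 1 < i') (h : w.symm ⟨i + 1, hi⟩ < w.symm ⟨i, by omega⟩)
    (h' : w.symm ⟨i' + 1, hi'⟩ < w.symm ⟨i', by omega⟩) :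
    ∃ T, IsRhombicTiling θ w T ∧ (sidePerimeterTiles θ w T).ncard ≠ 2 := by
  classical
  have hlt : (1 : Equiv.Perm (Fin n)) ⟨i, by omega⟩ < (1 : Equiv.Perm (Fin n)) ⟨i + 1, hi⟩ := by
    simp [Fin.lt_def]
  have e1 : flip 1 hi ⟨i', by omega⟩ = ⟨i', by omega⟩ :=
    flip_apply_of_ne 1 hi _ (by simp only; omega) (by simp only; omega)
  have e2 : flip 1 hi ⟨i' + 1, hi'⟩ = ⟨i' + 1, hi'⟩ :=
    flip_apply_of_ne 1 hi _ (by simp only; omega) (by simp only; omega)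
  have hlt' : flip 1 hi ⟨i', by omega⟩ < flip 1 hi ⟨i' + 1, hi'⟩ := by
    rw [e1, e2]
    simp [Fin.lt_def]
  -- At distance at least two, the second exchange does not touch the sides of the first, so both
  -- tiles rest on the left boundary. Any extension to `w` contains them.
  have hP := ((isPartialTiling_one hθ).insert_flipTile hθ hi hlt).insert_flipTile hθ hi' hlt'
  have hle : InvLE (flip (flip 1 hi) hi') w :=
    ((InvLE.one_le w).flip_le (hj := hi) h).flip_le (by rwa [e1, e2])
  obtain ⟨T, hsub, hT⟩ := hP.exists_extension hθ hle
  have hR := hT.isRhombicTiling hθ (by omega) hw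
  refine ⟨T, hR, ?_⟩
  obtain ⟨t, ht, j, hj, h1, h2, h3⟩ := (hR.isTilingBetween hθ (by omega)).exists_right_tile hθ
    (hw.one_ne (by omega))
  have hr := isRightPerimeter_of_eq hθ hj h1 h2 h3
  have hl : IsLeftPerimeter θ (flipTile θ 1 hi hlt) := (isLeftPerimeter_iff hθ).2 ⟨i, hi, rfl⟩
  have hl' : IsLeftPerimeter θ (flipTile θ (flip 1 hi) hi' hlt') := by
    refine nontrivial_of_pathSide_mem_edges hθ hi' fun k hk => ?_
    rw [← pathSide_flip_of_ne θ 1 hi k (by omega) (by omega)]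
    exact pathSide_mem_edges θ (flip 1 hi) hi' hlt' k hk
  refine ncard_sidePerimeterTiles_ne_two (t₁ := flipTile θ 1 hi hlt)
    (t₂ := flipTile θ (flip 1 hi) hi' hlt') (t₃ := t)
    ⟨hsub (by simp), Or.inl hl⟩ ⟨hsub (by simp), Or.inl hl'⟩ ⟨ht, Or.inr hr⟩ ?_ ?_ ?_
  · intro heq
    have := congrArg Rhombus.top heq
    rw [flipTile_top, flipTile_top, ← pathVertex_flip_of_le θ 1 hi le_rfl] at this
    have := pathVertex_injective hθ _ (by omega) (by omega) this
    omega
  · rintro rfl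
    exact not_isRightPerimeter_of_isLeftPerimeter hθ hn hw hl hr
  · rintro rfl
    exact not_isRightPerimeter_of_isLeftPerimeter hθ hn hw hl' hr

/-- If `w` has two distant right descents, then some tiling has two right-perimeter tiles. -/
lemma exists_tiling_of_right_descents (hθ : IsSideDirections θ) (hn : 2 < n)
    {w : Equiv.Perm (Fin n)} (hw : IsContiguous w) {j j' : ℕ} (hj : j + 1 < n) (hj' : j' + 1 < n)
    (hjj : j + 1 < j') (h : w ⟨j + 1, hj⟩ < w ⟨j, by omega⟩)
    (h' : w ⟨j' + 1, hj'⟩ < w ⟨j', by omega⟩) :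
    ∃ T, IsRhombicTiling θ w T ∧ (sidePerimeterTiles θ w T).ncard ≠ 2 := by
  classical
  have hlt : flip w hj ⟨j, by omega⟩ < flip w hj ⟨j + 1, hj⟩ := by
    rwa [flip_apply_fst, flip_apply_snd]
  have e1 : flip w hj ⟨j', by omega⟩ = w ⟨j', by omega⟩ :=
    flip_apply_of_ne w hj _ (by simp only; omega) (by simp only; omega)
  have e2 : flip w hj ⟨j' + 1, hj'⟩ = w ⟨j' + 1, hj'⟩ :=
    flip_apply_of_ne w hj _ (by simp only; omega) (by simp only; omega)
  have hlt' : flip (flip w hj) hj' ⟨j', by omega⟩ < flip (flip w hj) hj' ⟨j' + 1, hj'⟩ := by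
    rwa [flip_apply_fst, flip_apply_snd, e1, e2]
  -- Undo both descents of `w`, fill up to that path, and glue the two rhombi on last; this leaves
  -- both of them on the right boundary.
  obtain ⟨T₀, -, hT₀⟩ := (isPartialTiling_one hθ).exists_extension hθ
    (InvLE.one_le (flip (flip w hj) hj'))
  have hT₁ := hT₀.insert_flipTile hθ hj' hlt'
  rw [flip_flip] at hT₁
  have hT := hT₁.insert_flipTile hθ hj hlt
  rw [flip_flip] at hT
  have hR := hT.isRhombicTiling hθ (by omega) hw
  refine ⟨_, hR, ?_⟩
  obtain ⟨i, hi, hlt₁, hleft⟩ := (hR.isTilingBetween hθ (by omega)).exists_flipTile_mem hθ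
    (hw.one_ne (by omega))
  have hl : IsLeftPerimeter θ (flipTile θ 1 hi hlt₁) := (isLeftPerimeter_iff hθ).2 ⟨i, hi, rfl⟩
  have hr : IsRightPerimeter θ w (flipTile θ (flip w hj) hj hlt) := by
    refine nontrivial_of_pathSide_mem_edges hθ hj fun k hk => ?_
    have := pathSide_flip_mem_edges θ (flip w hj) hj hlt k hk
    rwa [flip_flip] at this
  have hr' : IsRightPerimeter θ w (flipTile θ (flip (flip w hj) hj') hj' hlt') := by
    refine nontrivial_of_pathSide_mem_edges hθ hj' fun k hk => ?_
    have := pathSide_flip_mem_edges θ (flip (flip w hj) hj') hj' hlt' k hk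
    rwa [flip_flip, pathSide_flip_of_ne θ w hj k (by omega) (by omega)] at this
  refine ncard_sidePerimeterTiles_ne_two (t₁ := flipTile θ (flip w hj) hj hlt)
    (t₂ := flipTile θ (flip (flip w hj) hj') hj' hlt') (t₃ := flipTile θ 1 hi hlt₁)
    ⟨by simp, Or.inr hr⟩ ⟨by simp, Or.inr hr'⟩ ⟨hleft, Or.inl hl⟩ ?_ ?_ ?_
  · intro heq
    have := congrArg Rhombus.top heq
    rw [flipTile_top, flipTile_top, pathVertex_flip_of_le θ (flip w hj) hj' le_rfl] at this
    have := pathVertex_injective hθ _ (by omega) (by omega) this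
    omega
  · intro heq
    exact not_isRightPerimeter_of_isLeftPerimeter hθ hn hw hl (heq ▸ hr)
  · intro heq
    exact not_isRightPerimeter_of_isLeftPerimeter hθ hn hw hl (heq ▸ hr')

end Elnitsky

end

theorem mainTheorem4 (n : ℕ) (hn : 2 < n)
    (θ : Fin n → ℝ) (hθ : Elnitsky.IsSideDirections θ)
    (w : Equiv.Perm (Fin n)) (hw : Elnitsky.IsContiguous w) :
    (∀ T : Finset (Elnitsky.Rhombus n), Elnitsky.IsRhombicTiling θ w T →
        (Elnitsky.sidePerimeterTiles θ w T).ncard = 2) ↔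
      ∃ k : ℕ, 1 ≤ k ∧ k ≤ n - 1 ∧
        (Elnitsky.oneLine w = List.range' (k + 1) (n - k) ++ List.range' 1 k ∨
          Elnitsky.oneLine w =
            List.range' (k + 1) (n - k) ++ [k] ++ List.range' 1 (k - 1)) := by
  rw [← Elnitsky.noDistantDescents_iff hw (by omega)]
  constructor
  · intro h
    rw [Elnitsky.noDistantDescents_toNatFun_iff, Elnitsky.noDistantDescents_toNatFun_iff]
    constructor
    · intro j j' hj hj' hd hd'
      by_contra hc
      obtain ⟨T, hT, hne⟩ := Elnitsky.exists_tiling_of_right_descents hθ hn hw hj hj'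
        (by omega) hd hd'
      exact hne (h T hT)
    · intro i i' hi hi' hd hd'
      by_contra hc
      obtain ⟨T, hT, hne⟩ := Elnitsky.exists_tiling_of_left_descents hθ hn hw hi hi'
        (by omega) hd hd'
      exact hne (h T hT)
  · rintro ⟨hR, hL⟩ T hT
    exact Elnitsky.ncard_sidePerimeterTiles_eq_two hθ hn hw hR hL hT
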